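/- Let $\square$ be the semi-cube category, i.e. the free strict monoidal category generated by an object $\mathbb I$ and two morphisms $d^0,d^1:\mathbb I\to 1$. Its objects are the powers $\mathbb I^k$, and its morphisms are the tensor products of copies of $d^0$, $d^1$ and $\mathrm{id}_{\mathbb I}$. For a natural number $n\ge 0$ let $f:\square_n\hookrightarrow\square$ be the full subcategory on $1,\mathbb I,\dots,\mathbb I^n$, let $f^*:\mathrm{Set}^{\square}\to\mathrm{Set}^{\square_n}$ be restriction of (covariant) functors along $f$, and let $f_!$ be its left adjoint. Equip $\mathrm{Set}^{\square}$ with the Day convolution $\otimes$. A lex category is a category with finite limits, and a lex functor is a functor preserving them. A free lex category on a category $K$ is a lex category $L$ with a functor $j:K\to L$ such that, for every lex category $E$, restriction along $j$ is an equivalence from the category of lex functors $L\to E$ to the category of functors $K\to E$. A monoidal lex category is a lex category with a (non-strict) monoidal structure whose tensor product preserves finite limits in each variable. For a monoidal lex category $M$, an $M$-parametric lex category is a lex category $C$ with a (non-strict) left action $M\times C\to C$ of $M$ preserving finite limits in each variable. Then: 1. There is a monoidal structure $\otimes_n$ on $\mathrm{Set}^{\square_n}$ for which $f^*$ is strong monoidal.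 One has $X\otimes_n Y\cong f^*(f_!X\otimes f_!Y)$ naturally in $X$ and $Y$, and $\otimes_n$ preserves small colimits in each variable. 2. A free (small) lex category on $\square_n$ exists. Every free lex category $j:\square_n\to L$ carries a (non-strict) monoidal structure making it a monoidal lex category, such that the functor $L\to(\mathrm{Set}^{\square_n})^{op}$, $X\mapsto \mathrm{Hom}_L(X,j(-))$, is fully faithful, lex and strong monoidal with respect to $\otimes_n$. 3. With this monoidal structure, the cofreely $L$-parametric lex category generated by a lex category $D$ is the category $D^{\square_n}$ of $n$-truncated semi-cubical objects in $D$: it carries an action of $L$ making it an $L$-parametric lex category, and for every $L$-parametric lex category $C$, composition with the evaluation $D^{\square_n}\to D$ at the object $1=\mathbb I^0$ is an equivalence from the category of equivariant lex functors $C\to D^{\square_n}$ (functors commuting with the actions up to coherent isomorphism, with equivariant natural transformations) to the category of lex functors $C\to D$. -/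

import Mathlib

open CategoryTheory MonoidalCategory Limits

universe v u v₁ u₁ v₂ u₂ v₃ u₃

/-! ## Semi-cubes -/

/-- Objects of the semi-cube category: the tensor powers `𝕀^dim` of the interval. -/
@[ext]
structure SemiCube where
  dim : ℕ

namespace SemiCube

/-- A morphism `𝕀^m ⟶ 𝕀^n` is a word of length `m` in the letters `id`, `d⁰`, `d¹`, with exactly
`n` letters `id`; it denotes the tensor product of its letters. -/
inductive Word : ℕ → ℕ → Type
  | nil : Word 0 0
  | keep {m n : ℕ} (f : Word m n) : Word (m + 1) (n + 1)
  | face {m n : ℕ} (ε : Bool) (f : Word m n) : Word (m + 1) n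

namespace Word

/-- The word `id ⊗ ⋯ ⊗ id`. -/
protected def id : (n : ℕ) → Word n n
  | 0 => nil
  | n + 1 => keep (Word.id n)

/-- Composition (in diagrammatic order): the letters of `g` are substituted for the letters
`id` of `f`. -/
def comp : {l m n : ℕ} → Word l m → Word m n → Word l n
  | _, _, _, nil, g => g
  | _, _, _, keep f, keep g => keep (comp f g)
  | _, _, _, keep f, face ε g => face ε (comp f g)
  | _, _, _, face ε f, g => face ε (comp f g)

/-- Tensor product: concatenation of words, `f` followed by `g`. -/
def tensor : {m n m' n' : ℕ} → Word m n → Word m' n' → Word (m' + m) (n' + n)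
  | _, _, _, _, nil, g => g
  | _, _, _, _, keep f, g => keep (tensor f g)
  | _, _, _, _, face ε f, g => face ε (tensor f g)

theorem id_comp {m n : ℕ} (f : Word m n) : comp (Word.id m) f = f := by
  induction f with
  | nil => rfl
  | keep f ih => simp [Word.id, comp, ih]
  | face ε f ih => simp [Word.id, comp, ih]

theorem comp_id {m n : ℕ} (f : Word m n) : comp f (Word.id n) = f := by
  induction f with
  | nil => rfl
  | keep f ih => simp [Word.id, comp, ih]
  | face ε f ih => simp [comp, ih]

theorem assoc {k l m n : ℕ} (f : Word k l) (g : Word l m) (h : Word m n) :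
    comp (comp f g) h = comp f (comp g h) := by
  induction f generalizing m n with
  | nil => rfl
  | face ε f ih => simp [comp, ih]
  | keep f ih =>
    cases g with
    | face ε g => simp [comp, ih]
    | keep g =>
      cases h with
      | keep h => simp [comp, ih]
      | face ε h => simp [comp, ih]

theorem tensor_id (m n : ℕ) : tensor (Word.id m) (Word.id n) = Word.id (n + m) := by
  induction m with
  | zero => rfl
  | succ m ih => simp [Word.id, tensor, ih]

theorem tensor_comp {l m n l' m' n' : ℕ} (f : Word l m) (f' : Word m n)
    (g : Word l' m') (g' : Word m' n') :
    tensor (comp f f') (comp g g') = comp (tensor f g) (tensor f' g') := by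
  induction f generalizing n with
  | nil => cases f' ; rfl
  | face ε f ih => simp [comp, tensor, ih]
  | keep f ih =>
    cases f' with
    | keep f' => simp [comp, tensor, ih]
    | face ε f' => simp [comp, tensor, ih]

end Word

instance : Category SemiCube where
  Hom X Y := Word X.dim Y.dim
  id X := Word.id X.dim
  comp f g := Word.comp f g
  id_comp := Word.id_comp
  comp_id := Word.comp_id
  assoc := Word.assoc

theorem eqToHom_succ {m n : ℕ} (h : (⟨m⟩ : SemiCube) = ⟨n⟩)
    (h' : (⟨m + 1⟩ : SemiCube) = ⟨n + 1⟩) :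
    (eqToHom h' : Word (m + 1) (n + 1)) = Word.keep (eqToHom h : Word m n) := by
  cases h
  rfl

/-- The tensor product `𝕀^a ⊗ 𝕀^b = 𝕀^(a+b)`. -/
instance : MonoidalCategoryStruct SemiCube where
  tensorObj X Y := ⟨Y.dim + X.dim⟩
  tensorHom f g := Word.tensor f g
  whiskerLeft X _ _ g := Word.tensor (Word.id X.dim) g
  whiskerRight f Y := Word.tensor f (Word.id Y.dim)
  tensorUnit := ⟨0⟩
  associator X Y Z := eqToIso (SemiCube.ext (Nat.add_assoc Z.dim Y.dim X.dim).symm)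
  leftUnitor X := eqToIso (SemiCube.ext (Nat.add_zero X.dim))
  rightUnitor X := eqToIso (SemiCube.ext (Nat.zero_add X.dim))

theorem assoc_aux {a a' b b' c c' : ℕ} (f : Word a a') (g : Word b b') (h : Word c c')
    (e : (⟨c + (b + a)⟩ : SemiCube) = ⟨c + b + a⟩)
    (e' : (⟨c' + (b' + a')⟩ : SemiCube) = ⟨c' + b' + a'⟩) :
    Word.comp (Word.tensor (Word.tensor f g) h) (eqToHom e' : Word _ _) =
      Word.comp (eqToHom e : Word _ _) (Word.tensor f (Word.tensor g h)) := by
  induction f with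
  | nil => exact (Word.comp_id _).trans (Word.id_comp _).symm
  | keep f ih =>
    have := ih (SemiCube.ext (Nat.add_assoc _ _ _).symm) (SemiCube.ext (Nat.add_assoc _ _ _).symm)
    rw [eqToHom_succ (SemiCube.ext (Nat.add_assoc _ _ _).symm) e',
      eqToHom_succ (SemiCube.ext (Nat.add_assoc _ _ _).symm) e]
    exact congrArg Word.keep this
  | face ε f ih =>
    have := ih (SemiCube.ext (Nat.add_assoc _ _ _).symm) e'
    rw [eqToHom_succ (SemiCube.ext (Nat.add_assoc _ _ _).symm) e]
    exact congrArg (Word.face ε) this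

theorem rightUnit_aux {a a' : ℕ} (f : Word a a')
    (e : (⟨0 + a⟩ : SemiCube) = ⟨a⟩) (e' : (⟨0 + a'⟩ : SemiCube) = ⟨a'⟩) :
    Word.comp (Word.tensor f Word.nil) (eqToHom e' : Word _ _) =
      Word.comp (eqToHom e : Word _ _) f := by
  induction f with
  | nil => rfl
  | keep f ih =>
    have := ih (SemiCube.ext (Nat.zero_add _)) (SemiCube.ext (Nat.zero_add _))
    rw [eqToHom_succ (SemiCube.ext (Nat.zero_add _)) e',
      eqToHom_succ (SemiCube.ext (Nat.zero_add _)) e]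
    exact congrArg Word.keep this
  | face ε f ih =>
    have := ih (SemiCube.ext (Nat.zero_add _)) e'
    rw [eqToHom_succ (SemiCube.ext (Nat.zero_add _)) e]
    exact congrArg (Word.face ε) this

theorem eqToHom_whiskerRight {X Y : SemiCube} (h : X = Y) (Z : SemiCube) :
    eqToHom h ▷ Z = eqToHom (congrArg (fun W : SemiCube => W ⊗ Z) h) := by
  cases h
  exact Word.tensor_id _ _

theorem whiskerLeft_eqToHom {X Y : SemiCube} (h : X = Y) (Z : SemiCube) :
    Z ◁ eqToHom h = eqToHom (congrArg (fun W : SemiCube => Z ⊗ W) h) := by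
  cases h
  exact Word.tensor_id _ _

theorem associator_hom_eq (X Y Z : SemiCube) :
    (α_ X Y Z).hom = eqToHom (SemiCube.ext (Nat.add_assoc Z.dim Y.dim X.dim).symm) := rfl

theorem leftUnitor_hom_eq (X : SemiCube) :
    (λ_ X).hom = eqToHom (SemiCube.ext (Nat.add_zero X.dim)) := rfl

theorem rightUnitor_hom_eq (X : SemiCube) :
    (ρ_ X).hom = eqToHom (SemiCube.ext (Nat.zero_add X.dim)) := rfl

/-- The strict monoidal structure of the semi-cube category. -/
instance : MonoidalCategory SemiCube where
  tensorHom_def f g := by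
    change Word.tensor f g = Word.comp (Word.tensor f (Word.id _)) (Word.tensor (Word.id _) g)
    rw [← Word.tensor_comp, Word.comp_id, Word.id_comp]
  id_tensorHom_id X Y := Word.tensor_id _ _
  tensorHom_comp_tensorHom f₁ f₂ g₁ g₂ := (Word.tensor_comp f₁ g₁ f₂ g₂).symm
  whiskerLeft_id X Y := Word.tensor_id _ _
  id_whiskerRight X Y := Word.tensor_id _ _
  associator_naturality f g h := assoc_aux f g h
    (SemiCube.ext (Nat.add_assoc _ _ _).symm) (SemiCube.ext (Nat.add_assoc _ _ _).symm)
  leftUnitor_naturality f := (Word.comp_id _).trans (Word.id_comp _).symm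
  rightUnitor_naturality f := rightUnit_aux f (SemiCube.ext (Nat.zero_add _)) (SemiCube.ext (Nat.zero_add _))
  pentagon W X Y Z := by
    simp only [associator_hom_eq, eqToHom_whiskerRight, whiskerLeft_eqToHom]
    exact (congrArg _ (eqToHom_trans _ _)).trans
      ((eqToHom_trans _ _).trans (eqToHom_trans _ _).symm)
  triangle X Y := by
    simp only [associator_hom_eq, leftUnitor_hom_eq, rightUnitor_hom_eq, eqToHom_whiskerRight,
      whiskerLeft_eqToHom]
    exact eqToHom_trans _ _

end SemiCube

/-- The `n`-truncated semi-cube category `□ₙ`: the full subcategory on `1, 𝕀, …, 𝕀^n`. -/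
abbrev TruncSemiCube (n : ℕ) : Type :=
  ObjectProperty.FullSubcategory (fun X : SemiCube => X.dim ≤ n)

namespace TruncSemiCube

/-- The inclusion of `□ₙ` into `□`. -/
abbrev incl (n : ℕ) : TruncSemiCube n ⥤ SemiCube :=
  ObjectProperty.ι _

/-- The monoidal unit `1 = 𝕀^0`, as an object of `□ₙ`. -/
def point (n : ℕ) : TruncSemiCube n := ⟨𝟙_ SemiCube, Nat.zero_le n⟩

end TruncSemiCube

noncomputable section

/-! ## Semi-cubical sets and their truncations -/

open scoped DayFunctor in
/-- The category `Set^□` of functors `□ ⥤ Set`, with the Day convolution monoidal structure. -/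
abbrev SemiCubicalSet : Type (u + 1) := SemiCube ⊛⥤ Type u

/-- The category `Set^{□ₙ}` of functors `□ₙ ⥤ Set`. This is a type synonym, so that it does not
carry the pointwise monoidal structure of a functor category. -/
def TruncSet (n : ℕ) : Type (u + 1) := TruncSemiCube n ⥤ Type u

instance (n : ℕ) : Category.{u} (TruncSet.{u} n) :=
  inferInstanceAs (Category.{u} (TruncSemiCube n ⥤ Type u))

namespace TruncSet

/-- The restriction functor `f^* : Set^□ ⥤ Set^{□ₙ}` along the inclusion `f : □ₙ ⥤ □`. -/
def restrict (n : ℕ) : SemiCubicalSet.{u} ⥤ TruncSet.{u} n :=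
  (DayFunctor.equiv SemiCube (Type u)).functor ⋙
    (Functor.whiskeringLeft _ _ (Type u)).obj (TruncSemiCube.incl n)

/-- The left adjoint `f_! : Set^{□ₙ} ⥤ Set^□` of the restriction (left Kan extension). -/
def extend (n : ℕ) : TruncSet.{u} n ⥤ SemiCubicalSet.{u} :=
  (TruncSemiCube.incl n).lan ⋙ (DayFunctor.equiv SemiCube (Type u)).inverse

/-- The bifunctor `(X, Y) ↦ f^* (f_! X ⊗ f_! Y)`, where `⊗` is Day convolution. -/
def dayTensor (n : ℕ) : TruncSet.{u} n ⥤ TruncSet.{u} n ⥤ TruncSet.{u} n :=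
  extend n ⋙ curriedTensor SemiCubicalSet.{u} ⋙
    (Functor.whiskeringLeft _ _ _).obj (extend n) ⋙
      (Functor.whiskeringRight _ _ _).obj (restrict n)

/-- For `j : □ₙ ⥤ L`, the functor `L ⥤ (Set^{□ₙ})ᵒᵖ`, `X ↦ (k ↦ Hom_L (X, j k))`. -/
def nerve {n : ℕ} {L : Type u} [SmallCategory L] (j : TruncSemiCube n ⥤ L) :
    L ⥤ (TruncSet.{u} n)ᵒᵖ :=
  Functor.rightOp (D := TruncSet.{u} n)
    (coyoneda ⋙ (Functor.whiskeringLeft (TruncSemiCube n) L (Type u)).obj j)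

end TruncSet

/-! ## Lex categories -/

/-- `j : K ⥤ L` exhibits `L` as the free lex category generated by `K`: `L` has finite limits and,
for every category `E` with finite limits, restriction along `j` is an equivalence from finite
limit preserving functors `L ⥤ E` to functors `K ⥤ E`. -/
structure IsFreeLex {K : Type u₁} [Category.{v₁} K] {L : Type u} [Category.{v} L]
    (j : K ⥤ L) : Prop where
  hasFiniteLimits : HasFiniteLimits L
  isEquivalence (E : Type u) [Category.{v} E] [HasFiniteLimits E] :
    (LeftExactFunctor.forget L E ⋙ (Functor.whiskeringLeft K L E).obj j).IsEquivalence

/-- A monoidal lex category: a monoidal category with finite limits, whose tensor product commutes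
with finite limits in each variable. -/
class IsLexMonoidal (M : Type u) [Category.{v} M] [MonoidalCategory M] : Prop where
  hasFiniteLimits : HasFiniteLimits M
  tensorLeft_lex (X : M) : PreservesFiniteLimits (tensorLeft X)
  tensorRight_lex (X : M) : PreservesFiniteLimits (tensorRight X)

/-- An `M`-parametric lex category: a category with finite limits and an action of `M` which
commutes with finite limits in each variable. -/
class IsLexModule (M : Type u) [Category.{v} M] [MonoidalCategory M]
    (C : Type u₁) [Category.{v₁} C] [MonoidalLeftAction M C] : Prop where
  hasFiniteLimits : HasFiniteLimits C
  actionLeft_lex (m : M) : PreservesFiniteLimits (MonoidalLeftAction.actionLeft C m)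
  actionRight_lex (c : C) : PreservesFiniteLimits (MonoidalLeftAction.actionRight M c)

/-- Equivariant lex functors between categories with an action of `M`. -/
structure EquivariantLexFunctor (M : Type u) [Category.{v} M] [MonoidalCategory M]
    (C : Type u₁) [Category.{v₁} C] [MonoidalLeftAction M C]
    (P : Type u₂) [Category.{v₂} P] [MonoidalLeftAction M P] where
  functor : C ⥤ P
  lex : PreservesFiniteLimits functor
  linear : functor.LeftLinear M

namespace EquivariantLexFunctor

variable {M : Type u} [Category.{v} M] [MonoidalCategory M]
  {C : Type u₁} [Category.{v₁} C] [MonoidalLeftAction M C]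
  {P : Type u₂} [Category.{v₂} P] [MonoidalLeftAction M P]

/-- The structure isomorphism `m ⊙ F c ⟶ F (m ⊙ c)` of an equivariant functor. -/
def lineator (F : EquivariantLexFunctor M C P) (m : M) (c : C) :
    MonoidalLeftActionStruct.actionObj m (F.functor.obj c) ⟶
      F.functor.obj (MonoidalLeftActionStruct.actionObj m c) :=
  F.linear.μₗ m c

/-- Equivariant natural transformations. -/
@[ext]
structure Hom (F G : EquivariantLexFunctor M C P) where
  natTrans : F.functor ⟶ G.functor
  equivariant (m : M) (c : C) :
    F.lineator m c ≫ natTrans.app (MonoidalLeftActionStruct.actionObj m c) =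
      MonoidalLeftActionStruct.actionHomRight m (natTrans.app c) ≫ G.lineator m c

instance : Category (EquivariantLexFunctor M C P) where
  Hom := Hom
  id F := ⟨𝟙 F.functor, fun m c => by simp⟩
  comp α β := ⟨α.natTrans ≫ β.natTrans, fun m c => by
    have h₁ := α.equivariant m c
    have h₂ := β.equivariant m c
    simp only [NatTrans.comp_app, MonoidalLeftAction.actionHomRight_comp, Category.assoc]
    rw [← h₂, reassoc_of% h₁]⟩
  id_comp α := Hom.ext (Category.id_comp α.natTrans)
  comp_id α := Hom.ext (Category.comp_id α.natTrans)
  assoc α β γ := Hom.ext (Category.assoc α.natTrans β.natTrans γ.natTrans)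

/-- Composition with a lex functor `ε : P ⥤ D`, forgetting equivariance. -/
def postcomp (M : Type u) [Category.{v} M] [MonoidalCategory M]
    (C : Type u₁) [Category.{v₁} C] [MonoidalLeftAction M C]
    {P : Type u₂} [Category.{v₂} P] [MonoidalLeftAction M P]
    {D : Type u₃} [Category.{v₃} D] (ε : P ⥤ D) (hε : PreservesFiniteLimits ε) :
    EquivariantLexFunctor M C P ⥤ (C ⥤ₗ D) :=
  ObjectProperty.lift (leftExactFunctor C D)
    { obj := fun F => F.functor ⋙ ε
      map := fun α => Functor.whiskerRight α.natTrans ε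
      map_id := fun _ => Functor.whiskerRight_id' ε
      map_comp := fun α β => Functor.whiskerRight_comp α.natTrans β.natTrans ε }
    (fun F => have := F.lex; comp_preservesFiniteLimits F.functor ε)

end EquivariantLexFunctor

/-- `ε : P ⥤ D` exhibits `P` as the cofreely `M`-parametric lex category generated by `D`:
`P` is an `M`-parametric lex category, `ε` is lex and, for every `M`-parametric lex category `C`,
composition with `ε` is an equivalence from equivariant lex functors `C ⥤ P` to lex functors
`C ⥤ D`. -/
structure IsCofreeLexModule (M : Type u) [Category.{v} M] [MonoidalCategory M]
    {P : Type u₂} [Category.{v₂} P] [MonoidalLeftAction M P]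
    {D : Type u₃} [Category.{v₃} D] (ε : P ⥤ D) : Prop where
  isLexModule : IsLexModule M P
  lex : PreservesFiniteLimits ε
  isEquivalence (C : Type u₁) [Category.{v₁} C] [MonoidalLeftAction M C] [IsLexModule M C] :
    (EquivariantLexFunctor.postcomp M C ε lex).IsEquivalence

end

/-!
*The tensor product.* A morphism `𝕀^a ⊗ 𝕀^b ⟶ 𝕀^k` of semi-cubes is uniquely of the form `f ⊗ g`.
Therefore the `k`-cubes of a Day convolution `X ⊗ Y` are the pairs of an `i`-cube of `X` and a
`j`-cube of `Y` with `i + j = k` (`SemiCubicalSet.ofSplitPairs_bijective`). In particular the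
`k`-cubes of `X ⊗ Y` for `k ≤ n` only depend on the cubes of `X` and `Y` of dimension at most `n`:
morphisms which are bijective in these dimensions are stable under `⊗`, and the Day convolution
descends to the localization of `Set^□` at them, which is `Set^{□ₙ}` because restriction has a
fully faithful left adjoint. It also follows that tensor products of finite truncated semi-cubical
sets are finite.

*The free lex category.* Let `K` be a category with finitely many objects and morphisms. The
opposite of the category of functors from `K` to finite sets, with the Yoneda embedding `j` of
`K`, is the free lex category on `K` (`isFreeLex_iff_isFiniteModel`). Indeed every object `X` is
the limit of the finite diagram of all `X ⟶ j k`, so that a lex functor is the right Kan extension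
of its restriction along `j`; and conversely these right Kan extensions are lex, because a
morphism from a finite limit to `j k` comes from a term of the diagram
(`IsFiniteLimitCompletion.preservesFiniteLimits`). This gives the universal property with respect
to lex categories of any size (`IsFiniteLimitCompletion.isEquivalence`). For `K = □ₙ` the functor
`X ↦ Hom (X, j -)` identifies `L` with the opposite of the category of finite truncated
semi-cubical sets, whose tensor product it inherits (`TruncSet.exists_monoidal_of_isFreeLex`).

*The cofreely parametric lex category.* For a monoidal category `M`, the category `M ⥤ D` with the
action `(m ⊙ F) x = F (x ⊗ m)` is coinduced: an equivariant functor `T : C ⥤ M ⥤ D` satisfies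
`T c m ≅ T (m ⊙ c) 1`, so it is determined by its values at the unit, which may be arbitrary
(`Functor.IsEquivariant.ext`, `Functor.exists_isEquivariant`, `coinduce`). When `M` is lex
monoidal this restricts to lex functors `M ⥤ D` (`isCofreeLexModule_of_fullyFaithful`). For
`M = L` these are, by right Kan extension, the functors `□ₙ ⥤ D`
(`IsFiniteLimitCompletion.exists_isCofreeLexModule`), and evaluation at the unit of `L` is
evaluation at the object `1` of `□ₙ`.
-/

/-! ### Cubes of a Day convolution -/

namespace SemiCube.Word

/-- The decomposition of a word on the tensor product of two cubes as a tensor product of words: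
`f ⊗ g` is sent to `(f, g)`. -/
def split : (a : ℕ) → {b k : ℕ} → Word (b + a) k → Σ i j : ℕ, Word a i × Word b j
  | 0, _, _, w => ⟨0, _, nil, w⟩
  | a + 1, _, _, keep w => ⟨_, _, keep (split a w).2.2.1, (split a w).2.2.2⟩
  | a + 1, _, _, face ε w => ⟨_, _, face ε (split a w).2.2.1, (split a w).2.2.2⟩

theorem split_tensor {a i b j : ℕ} (f : Word a i) (g : Word b j) :
    split a (tensor f g) = ⟨i, j, f, g⟩ := by
  induction f with
  | nil => rfl
  | keep f ih => simp only [tensor, split]; rw [ih]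
  | face ε f ih => simp only [tensor, split]; rw [ih]

/-- Every word on a tensor product of two cubes is a tensor product of words. -/
theorem tensor_cases {a b : ℕ} {P : (k : ℕ) → Word (b + a) k → Prop}
    (h : ∀ (i j : ℕ) (f : Word a i) (g : Word b j), P (j + i) (tensor f g)) (k : ℕ)
    (w : Word (b + a) k) : P k w := by
  induction a generalizing k with
  | zero => exact h 0 k nil w
  | succ a ih =>
    match k, w with
    | _, keep w =>
      exact ih (P := fun k w => P (k + 1) (keep w)) (fun i j f g => h _ _ (keep f) g) _ w
    | _, face ε w =>
      exact ih (P := fun k w => P k (face ε w)) (fun i j f g => h _ _ (face ε f) g) _ w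

theorem split_add {a b k : ℕ} (w : Word (b + a) k) : (split a w).2.1 + (split a w).1 = k := by
  refine tensor_cases (P := fun k w => (split a w).2.1 + (split a w).1 = k) (fun i j f g => ?_) k w
  rw [split_tensor]

theorem split_comp {a a' b b' k : ℕ} (u : Word a a') (v : Word b b') (w : Word (b' + a') k) :
    split a (comp (tensor u v) w) =
      ⟨_, _, comp u (split a' w).2.2.1, comp v (split a' w).2.2.2⟩ := by
  refine tensor_cases (P := fun k w => split a (comp (tensor u v) w) =
    ⟨_, _, comp u (split a' w).2.2.1, comp v (split a' w).2.2.2⟩) (fun i j f g => ?_) k w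
  rw [← tensor_comp, split_tensor, split_tensor]

theorem le {m n : ℕ} (w : Word m n) : n ≤ m := by
  induction w with
  | nil => exact le_rfl
  | keep w ih => exact Nat.succ_le_succ ih
  | face ε w ih => exact ih.trans (Nat.le_succ _)

theorem finite (m n : ℕ) : Finite (Word m n) := by
  induction m generalizing n with
  | zero =>
    refine Finite.of_injective (β := Unit) (fun _ => ()) ?_
    intro w w' _
    cases w; cases w'; rfl
  | succ m ih =>
    cases n with
    | zero =>
      refine Finite.of_surjective (α := Bool × Word m 0) (fun x => face x.1 x.2) ?_
      rintro (_ | _ | ⟨ε, w⟩)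
      exact ⟨(ε, w), rfl⟩
    | succ n =>
      refine Finite.of_surjective (α := Word m n ⊕ (Bool × Word m (n + 1)))
        (Sum.elim keep fun x => face x.1 x.2) ?_
      rintro (_ | w | ⟨ε, w⟩)
      · exact ⟨Sum.inl w, rfl⟩
      · exact ⟨Sum.inr (ε, w), rfl⟩

end SemiCube.Word

noncomputable section

open scoped DayFunctor

namespace SemiCubicalSet

open SemiCube

/-- The value of `X` on the `k`-cube `𝕀^k`. -/
abbrev cubes (X : SemiCubicalSet.{u}) (k : ℕ) : Type u := X.functor.obj ⟨k⟩

/-- The explicit form of the `k`-cubes of a Day convolution: pairs of cubes of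
complementary dimensions. -/
def SplitPairs (X Y : SemiCubicalSet.{u}) (k : ℕ) : Type u :=
  Σ p : {p : ℕ × ℕ // p.2 + p.1 = k}, X.cubes p.1.1 × Y.cubes p.1.2

/-- The canonical map `X_a × Y_b → (X ⊗ Y)_{a+b}`. -/
def mulCubes (X Y : SemiCubicalSet.{u}) {a b : ℕ} (x : X.cubes a) (y : Y.cubes b) :
    (X ⊗ Y).cubes (b + a) :=
  TypeCat.Hom.hom ((DayFunctor.η X Y).app (⟨a⟩, ⟨b⟩)) (Prod.mk x y)

theorem map_mulCubes (X Y : SemiCubicalSet.{u}) {a b i j : ℕ} (f : Word a i) (g : Word b j)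
    (x : X.cubes a) (y : Y.cubes b) :
    (X ⊗ Y).functor.map (X := ⟨b + a⟩) (Y := ⟨j + i⟩) (Word.tensor f g) (mulCubes X Y x y) =
      mulCubes X Y (X.functor.map (X := ⟨a⟩) (Y := ⟨i⟩) f x)
        (Y.functor.map (X := ⟨b⟩) (Y := ⟨j⟩) g y) := by
  have := (DayFunctor.η X Y).naturality (X := (⟨a⟩, ⟨b⟩)) (Y := (⟨i⟩, ⟨j⟩)) (f, g)
  exact (congrArg (fun φ => TypeCat.Hom.hom φ (Prod.mk x y)) this).symm

/-- The comparison map from pairs of cubes to the Day convolution. -/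
def ofSplitPairs (X Y : SemiCubicalSet.{u}) (k : ℕ) (s : SplitPairs X Y k) : (X ⊗ Y).cubes k :=
  (X ⊗ Y).functor.map (eqToHom (SemiCube.ext s.1.2)) (mulCubes X Y s.2.1 s.2.2)

/-- The pair of cubes obtained from a pair by applying a pair of words. -/
def applyWords (X Y : SemiCubicalSet.{u}) {a b k : ℕ} (s : Σ i j : ℕ, Word a i × Word b j)
    (h : s.2.1 + s.1 = k) (x : X.cubes a) (y : Y.cubes b) : SplitPairs X Y k :=
  ⟨⟨(s.1, s.2.1), h⟩, X.functor.map (X := ⟨a⟩) (Y := ⟨s.1⟩) s.2.2.1 x,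
    Y.functor.map (X := ⟨b⟩) (Y := ⟨s.2.1⟩) s.2.2.2 y⟩

theorem applyWords_congr (X Y : SemiCubicalSet.{u}) {a b k : ℕ}
    {s s' : Σ i j : ℕ, Word a i × Word b j} (e : s = s')
    (h : s.2.1 + s.1 = k) (x : X.cubes a) (y : Y.cubes b) :
    applyWords X Y s h x y = applyWords X Y s' (e ▸ h) x y := by
  subst e
  rfl

theorem ofSplitPairs_applyWords (X Y : SemiCubicalSet.{u}) {a b : ℕ} (k : ℕ)
    (w : Word (b + a) k) (x : X.cubes a) (y : Y.cubes b) :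
    ofSplitPairs X Y k (applyWords X Y (Word.split a w) (Word.split_add w) x y) =
      (X ⊗ Y).functor.map (X := ⟨b + a⟩) (Y := ⟨k⟩) w (mulCubes X Y x y) := by
  refine Word.tensor_cases (P := fun k w =>
    ofSplitPairs X Y k (applyWords X Y (Word.split a w) (Word.split_add w) x y) =
      (X ⊗ Y).functor.map (X := ⟨b + a⟩) (Y := ⟨k⟩) w (mulCubes X Y x y)) (fun i j f g => ?_) k w
  rw [map_mulCubes, applyWords_congr X Y (Word.split_tensor f g)]
  exact congrArg (fun φ => TypeCat.Hom.hom φ _)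
    ((X ⊗ Y).functor.map_id (⟨j + i⟩ : SemiCube))

theorem applyWords_split_comp (X Y : SemiCubicalSet.{u}) {a a' b b' k : ℕ} (f : Word a a')
    (g : Word b b') (w : Word (b' + a') k) (x : X.cubes a) (y : Y.cubes b)
    {w' : Word (b + a) k} (hw : Word.comp (Word.tensor f g) w = w') :
    applyWords X Y (Word.split a' w) (Word.split_add w)
        (X.functor.map (X := ⟨a⟩) (Y := ⟨a'⟩) f x) (Y.functor.map (X := ⟨b⟩) (Y := ⟨b'⟩) g y) =
      applyWords X Y (Word.split a w') (Word.split_add w') x y := by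
  subst hw
  rw [applyWords_congr X Y (Word.split_comp f g w)]
  refine congrArg (Sigma.mk _) (Prod.ext ?_ ?_)
  · exact (congrArg (fun φ => TypeCat.Hom.hom φ x) (X.functor.map_comp (X := ⟨a⟩) (Y := ⟨a'⟩)
      (Z := ⟨_⟩) f (Word.split a' w).2.2.1)).symm
  · exact (congrArg (fun φ => TypeCat.Hom.hom φ y) (Y.functor.map_comp (X := ⟨b⟩) (Y := ⟨b'⟩)
      (Z := ⟨_⟩) g (Word.split a' w).2.2.2)).symm

/-- The `k`-cubes of `X ⊗ Y` are the pairs of an `i`-cube of `X` and a `j`-cube of `Y` with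
`i + j = k`: a morphism `𝕀^a ⊗ 𝕀^b ⟶ 𝕀^k` is uniquely a tensor product `f ⊗ g`, so that each
connected component of the indexing category of the Day convolution has a terminal object. -/
theorem ofSplitPairs_bijective (X Y : SemiCubicalSet.{u}) (k : ℕ) :
    Function.Bijective (ofSplitPairs X Y k) := by
  open LawfulDayConvolutionMonoidalCategoryStruct in
  have hc := isPointwiseLeftKanExtensionConvolutionExtensionUnit (C := SemiCube)
    (V := Type u) X Y ⟨k⟩
  let F := CostructuredArrow.proj (tensor SemiCube) (⟨k⟩ : SemiCube) ⋙
    externalProduct X.functor Y.functor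
  let c' : F.CoconeTypes :=
    { pt := SplitPairs X Y k
      ι := fun g z =>
        let z' : X.functor.obj g.left.1 × Y.functor.obj g.left.2 := z
        let w : Word (g.left.2.dim + g.left.1.dim) k := g.hom
        applyWords X Y (Word.split _ w) (Word.split_add w) z'.1 z'.2
      ι_naturality := fun {g g'} f => funext fun z =>
        let z' : X.functor.obj g.left.1 × Y.functor.obj g.left.2 := z
        applyWords_split_comp X Y f.left.1 f.left.2 _ z'.1 z'.2 (CostructuredArrow.w f) }
  have hc' := (Types.isColimit_iff_coconeTypesIsColimit _).1 ⟨hc⟩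
  constructor
  · refine Function.LeftInverse.injective (g := hc'.desc c') ?_
    rintro ⟨⟨⟨i, j⟩, h⟩, x, y⟩
    dsimp at h
    subst h
    refine (hc'.fac_apply c' (CostructuredArrow.mk (Y := ((⟨i⟩, ⟨j⟩) : SemiCube × SemiCube))
      (𝟙 (⟨j + i⟩ : SemiCube))) (Prod.mk x y)).trans ?_
    have e : Word.split i (Word.id (j + i)) = ⟨i, j, Word.id i, Word.id j⟩ := by
      rw [← Word.tensor_id, Word.split_tensor]
    refine (applyWords_congr X Y e _ x y).trans ?_
    refine congrArg (Sigma.mk _) (Prod.ext ?_ ?_)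
    · exact congrArg (fun φ => TypeCat.Hom.hom φ x) (X.functor.map_id ⟨i⟩)
    · exact congrArg (fun φ => TypeCat.Hom.hom φ y) (Y.functor.map_id ⟨j⟩)
  · intro z
    obtain ⟨g, p, hz⟩ := hc'.ι_jointly_surjective z
    let p' : X.functor.obj g.left.1 × Y.functor.obj g.left.2 := p
    exact ⟨_, (ofSplitPairs_applyWords X Y k g.hom p'.1 p'.2).trans hz⟩

end SemiCubicalSet

end

/-! ### The monoidal structure on truncated semi-cubical sets -/

noncomputable section

open scoped DayFunctor

namespace SemiCubicalSet

open SemiCube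

/-- The map of pairs of cubes induced by a pair of morphisms. -/
def SplitPairs.map {X X' Y Y' : SemiCubicalSet.{u}} (f : X ⟶ X') (g : Y ⟶ Y') {k : ℕ}
    (s : SplitPairs X Y k) : SplitPairs X' Y' k :=
  ⟨s.1, f.natTrans.app ⟨s.1.1.1⟩ s.2.1, g.natTrans.app ⟨s.1.1.2⟩ s.2.2⟩

theorem tensorHom_ofSplitPairs {X X' Y Y' : SemiCubicalSet.{u}} (f : X ⟶ X') (g : Y ⟶ Y') (k : ℕ)
    (s : SplitPairs X Y k) :
    (f ⊗ₘ g).natTrans.app ⟨k⟩ (ofSplitPairs X Y k s) = ofSplitPairs X' Y' k (s.map f g) := by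
  obtain ⟨⟨⟨i, j⟩, h⟩, x, y⟩ := s
  refine (congrArg (fun φ => TypeCat.Hom.hom φ (mulCubes X Y x y))
    ((f ⊗ₘ g).natTrans.naturality (eqToHom (SemiCube.ext h)))).trans ?_
  refine congrArg (fun z => (X' ⊗ Y').functor.map (eqToHom (SemiCube.ext h)) z) ?_
  exact congrArg (fun φ => TypeCat.Hom.hom φ (Prod.mk x y))
    (LawfulDayConvolutionMonoidalCategoryStruct.convolutionExtensionUnit_comp_ι_map_tensorHom_app
      SemiCube (Type u) f g ⟨i⟩ ⟨j⟩)

theorem SplitPairs.map_bijective {X X' Y Y' : SemiCubicalSet.{u}} (f : X ⟶ X') (g : Y ⟶ Y')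
    {k : ℕ} (hf : ∀ i ≤ k, Function.Bijective (f.natTrans.app ⟨i⟩))
    (hg : ∀ i ≤ k, Function.Bijective (g.natTrans.app ⟨i⟩)) :
    Function.Bijective (SplitPairs.map f g (k := k)) :=
  (Equiv.sigmaCongrRight fun p : {p : ℕ × ℕ // p.2 + p.1 = k} =>
    (Equiv.ofBijective _ (hf p.1.1 (by have := p.2; omega))).prodCongr
      (Equiv.ofBijective _ (hg p.1.2 (by have := p.2; omega)))).bijective

/-- The cubes of `X ⊗ Y` in dimensions at most `n` only depend on those of `X` and `Y`. -/
theorem tensorHom_bijective {X X' Y Y' : SemiCubicalSet.{u}} (f : X ⟶ X') (g : Y ⟶ Y') {k : ℕ}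
    (hf : ∀ i ≤ k, Function.Bijective (f.natTrans.app ⟨i⟩))
    (hg : ∀ i ≤ k, Function.Bijective (g.natTrans.app ⟨i⟩)) :
    Function.Bijective ((f ⊗ₘ g).natTrans.app ⟨k⟩) := by
  rw [← Function.Bijective.of_comp_iff _ (ofSplitPairs_bijective X Y k)]
  have : (f ⊗ₘ g).natTrans.app ⟨k⟩ ∘ ofSplitPairs X Y k =
      ofSplitPairs X' Y' k ∘ SplitPairs.map f g :=
    funext fun s => tensorHom_ofSplitPairs f g k s
  rw [this]
  exact (ofSplitPairs_bijective X' Y' k).comp (SplitPairs.map_bijective f g hf hg)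

theorem finite_cubes_tensor (X Y : SemiCubicalSet.{u}) {k : ℕ} (hX : ∀ i ≤ k, Finite (X.cubes i))
    (hY : ∀ i ≤ k, Finite (Y.cubes i)) : Finite ((X ⊗ Y).cubes k) := by
  have : Finite {p : ℕ × ℕ // p.2 + p.1 = k} :=
    Finite.of_injective (β := Fin (k + 1) × Fin (k + 1))
      (fun p => (⟨p.1.1, by have := p.2; omega⟩, ⟨p.1.2, by have := p.2; omega⟩))
      (fun p q h => by
        simp only [Prod.mk.injEq, Fin.mk.injEq] at h
        exact Subtype.ext (Prod.ext h.1 h.2))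
  have (p : {p : ℕ × ℕ // p.2 + p.1 = k}) : Finite (X.cubes p.1.1 × Y.cubes p.1.2) := by
    have := hX p.1.1 (by have := p.2; omega)
    have := hY p.1.2 (by have := p.2; omega)
    infer_instance
  have : Finite (SplitPairs X Y k) := inferInstanceAs (Finite (Sigma _))
  exact Finite.of_surjective _ (ofSplitPairs_bijective X Y k).2

/-- The unit of the Day convolution is represented by the point `𝕀^0`, and a word of length zero is
empty. -/
theorem exists_unit_cube {k : ℕ} (z : (𝟙_ SemiCubicalSet.{u}).cubes k) :
    ∃ w : Word 0 k, (𝟙_ SemiCubicalSet.{u}).functor.map (X := ⟨0⟩) (Y := ⟨k⟩) w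
      (DayFunctor.ν SemiCube (Type u) PUnit.unit) = z := by
  have hc := LawfulDayConvolutionMonoidalCategoryStruct.isPointwiseLeftKanExtensionUnitUnit
    SemiCube (Type u) SemiCubicalSet.{u} ⟨k⟩
  obtain ⟨g, p, hz⟩ := Types.jointly_surjective_of_isColimit hc z
  exact ⟨g.hom, hz⟩

theorem isEmpty_unit_cubes (k : ℕ) : IsEmpty ((𝟙_ SemiCubicalSet.{u}).cubes (k + 1)) :=
  ⟨fun z => by obtain ⟨w, -⟩ := exists_unit_cube z; cases w⟩

theorem subsingleton_unit_cubes (k : ℕ) : Subsingleton ((𝟙_ SemiCubicalSet.{u}).cubes k) := by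
  refine ⟨fun z z' => ?_⟩
  obtain ⟨w, rfl⟩ := exists_unit_cube z
  obtain ⟨w', rfl⟩ := exists_unit_cube z'
  cases w; cases w'; rfl

theorem nonempty_unit_cubes : Nonempty ((𝟙_ SemiCubicalSet.{u}).cubes 0) :=
  ⟨DayFunctor.ν SemiCube (Type u) PUnit.unit⟩

/-- The internal hom `b ↦ Hom (X, Z (- ⊗ 𝕀^b))`, right adjoint to `X ⊗ -`. -/
def homLeft (X Z : SemiCubicalSet.{u}) : SemiCubicalSet.{u} :=
  .mk (tensoringRight SemiCube ⋙ (Functor.whiskeringRight _ _ _).obj Z.functor ⋙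
    coyoneda.obj (Opposite.op X.functor))

/-- The internal hom `a ↦ Hom (Y, Z (𝕀^a ⊗ -))`, right adjoint to `- ⊗ Y`. -/
def homRight (Y Z : SemiCubicalSet.{u}) : SemiCubicalSet.{u} :=
  .mk (tensoringLeft SemiCube ⋙ (Functor.whiskeringRight _ _ _).obj Z.functor ⋙
    coyoneda.obj (Opposite.op Y.functor))

theorem map_mulCubes_left (X Y : SemiCubicalSet.{u}) {a b : ℕ} {i : ℕ} (f : Word a i)
    (x : X.cubes a) (y : Y.cubes b) :
    (X ⊗ Y).functor.map (X := ⟨b + a⟩) (Y := ⟨b + i⟩) (Word.tensor f (Word.id b))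
      (mulCubes X Y x y) = mulCubes X Y (X.functor.map (X := ⟨a⟩) (Y := ⟨i⟩) f x) y :=
  (map_mulCubes X Y f (Word.id b) x y).trans (congrArg (fun φ => mulCubes X Y _
    (TypeCat.Hom.hom φ y)) (Y.functor.map_id ⟨b⟩))

theorem map_mulCubes_right (X Y : SemiCubicalSet.{u}) {a b : ℕ} {j : ℕ} (g : Word b j)
    (x : X.cubes a) (y : Y.cubes b) :
    (X ⊗ Y).functor.map (X := ⟨b + a⟩) (Y := ⟨j + a⟩) (Word.tensor (Word.id a) g)
      (mulCubes X Y x y) = mulCubes X Y x (Y.functor.map (X := ⟨b⟩) (Y := ⟨j⟩) g y) :=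
  (map_mulCubes X Y (Word.id a) g x y).trans (congrArg (fun φ => mulCubes X Y
    (TypeCat.Hom.hom φ x) _) (X.functor.map_id ⟨a⟩))

/-- A family of maps `X_a × Y_b → Z_{a+b}` natural in `a` and in `b` defines a morphism
`X ⊗ Y ⟶ Z`. -/
def tensorDesc {X Y Z : SemiCubicalSet.{u}}
    (m : ∀ a b : ℕ, X.cubes a → Y.cubes b → Z.cubes (b + a))
    (hl : ∀ (a b i : ℕ) (f : Word a i) (x : X.cubes a) (y : Y.cubes b),
      Z.functor.map (X := ⟨b + a⟩) (Y := ⟨b + i⟩) (Word.tensor f (Word.id b)) (m a b x y) =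
        m i b (X.functor.map (X := ⟨a⟩) (Y := ⟨i⟩) f x) y)
    (hr : ∀ (a b j : ℕ) (g : Word b j) (x : X.cubes a) (y : Y.cubes b),
      Z.functor.map (X := ⟨b + a⟩) (Y := ⟨j + a⟩) (Word.tensor (Word.id a) g) (m a b x y) =
        m a j x (Y.functor.map (X := ⟨b⟩) (Y := ⟨j⟩) g y)) :
    X ⊗ Y ⟶ Z :=
  DayFunctor.tensorDesc
    { app := fun p => ↾fun q : X.functor.obj p.1 × Y.functor.obj p.2 => m p.1.dim p.2.dim q.1 q.2
      naturality := fun p p' f => by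
        ext q
        let q' : X.functor.obj p.1 × Y.functor.obj p.2 := q
        have e : Word.tensor f.1 f.2 = Word.comp (Word.tensor f.1 (Word.id p.2.dim))
          (Word.tensor (Word.id p'.1.dim) f.2) := by
          rw [← Word.tensor_comp, Word.comp_id, Word.id_comp]
        have h := congrArg (fun φ => TypeCat.Hom.hom φ (m p.1.dim p.2.dim q'.1 q'.2))
          (Z.functor.map_comp (X := ⟨p.2.dim + p.1.dim⟩) (Y := ⟨p.2.dim + p'.1.dim⟩)
            (Z := ⟨p'.2.dim + p'.1.dim⟩)
            (Word.tensor f.1 (Word.id p.2.dim)) (Word.tensor (Word.id p'.1.dim) f.2))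
        refine Eq.symm ((congrArg (fun w => Z.functor.map (X := ⟨p.2.dim + p.1.dim⟩)
          (Y := ⟨p'.2.dim + p'.1.dim⟩) w (m p.1.dim p.2.dim q'.1 q'.2)) e).trans (h.trans ?_))
        refine (congrArg (fun z => Z.functor.map (X := ⟨p.2.dim + p'.1.dim⟩)
          (Y := ⟨p'.2.dim + p'.1.dim⟩) (Word.tensor (Word.id p'.1.dim) f.2) z)
          (hl _ _ _ f.1 q'.1 q'.2)).trans ?_
        exact hr _ _ _ f.2 _ q'.2 }

theorem tensorDesc_mulCubes {X Y Z : SemiCubicalSet.{u}}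
    (m : ∀ a b : ℕ, X.cubes a → Y.cubes b → Z.cubes (b + a)) (hl) (hr) {a b : ℕ}
    (x : X.cubes a) (y : Y.cubes b) :
    (tensorDesc (Z := Z) m hl hr).natTrans.app ⟨b + a⟩ (mulCubes X Y x y) = m a b x y :=
  congrArg (fun φ => TypeCat.Hom.hom φ (Prod.mk x y))
    (DayFunctor.η_comp_tensorDesc_app (F := X) (G := Y) (H := Z) _ ⟨a⟩ ⟨b⟩)

theorem tensor_hom_ext {X Y Z : SemiCubicalSet.{u}} {φ ψ : X ⊗ Y ⟶ Z}
    (h : ∀ (a b : ℕ) (x : X.cubes a) (y : Y.cubes b),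
      φ.natTrans.app ⟨b + a⟩ (mulCubes X Y x y) = ψ.natTrans.app ⟨b + a⟩ (mulCubes X Y x y)) :
    φ = ψ := by
  refine DayFunctor.tensor_hom_ext fun a b => ?_
  ext q
  let q' : X.functor.obj a × Y.functor.obj b := q
  exact h a.dim b.dim q'.1 q'.2

theorem natTrans_naturality {X Y : SemiCubicalSet.{u}} (φ : X ⟶ Y) {a b : ℕ} (w : Word a b)
    (x : X.cubes a) :
    φ.natTrans.app ⟨b⟩ (X.functor.map (X := ⟨a⟩) (Y := ⟨b⟩) w x) =
      Y.functor.map (X := ⟨a⟩) (Y := ⟨b⟩) w (φ.natTrans.app ⟨a⟩ x) :=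
  congrArg (fun f => TypeCat.Hom.hom f x)
    (φ.natTrans.naturality (X := ⟨a⟩) (Y := ⟨b⟩) w)

/-- The adjunction bijection between `X ⊗ -` and the internal hom. -/
def homLeftEquiv (X Y Z : SemiCubicalSet.{u}) : (X ⊗ Y ⟶ Z) ≃ (Y ⟶ homLeft X Z) where
  toFun φ := .mk
    { app := fun b => ↾fun y =>
        { app := fun a => ↾fun x => φ.natTrans.app (a ⊗ b) (mulCubes X Y x y)
          naturality := fun a i f => by
            ext x
            exact (congrArg (fun z => φ.natTrans.app (i ⊗ b) z)
              (map_mulCubes_left X Y f x y)).symm.trans (natTrans_naturality φ _ _) }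
      naturality := fun b j g => by
        ext y
        refine NatTrans.ext (funext fun a => ?_)
        ext x
        exact (congrArg (fun z => φ.natTrans.app (a ⊗ j) z)
          (map_mulCubes_right X Y g x y)).symm.trans (natTrans_naturality φ _ _) }
  invFun ψ := tensorDesc
    (fun a b x y =>
      let χ : X.functor ⟶ tensorRight (⟨b⟩ : SemiCube) ⋙ Z.functor := ψ.natTrans.app ⟨b⟩ y
      χ.app ⟨a⟩ x)
    (fun a b i f x y => by
      let χ : X.functor ⟶ tensorRight (⟨b⟩ : SemiCube) ⋙ Z.functor := ψ.natTrans.app ⟨b⟩ y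
      exact (congrArg (fun φ => TypeCat.Hom.hom φ x)
        (χ.naturality (X := ⟨a⟩) (Y := ⟨i⟩) f)).symm)
    (fun a b j g x y => by
      have := natTrans_naturality ψ g y
      let χ : X.functor ⟶ tensorRight (⟨j⟩ : SemiCube) ⋙ Z.functor :=
        ψ.natTrans.app ⟨j⟩ (Y.functor.map (X := ⟨b⟩) (Y := ⟨j⟩) g y)
      exact (congrArg (fun φ : X.functor ⟶ tensorRight (⟨j⟩ : SemiCube) ⋙ Z.functor =>
        TypeCat.Hom.hom (φ.app ⟨a⟩) x) this).symm)
  left_inv φ := tensor_hom_ext fun a b x y => tensorDesc_mulCubes _ _ _ x y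
  right_inv ψ := by
    refine DayFunctor.hom_ext (NatTrans.ext (funext fun b => ?_))
    ext y
    refine NatTrans.ext (funext fun a => ?_)
    ext x
    exact tensorDesc_mulCubes _ _ _ x y

/-- The adjunction bijection between `- ⊗ Y` and the internal hom. -/
def homRightEquiv (Y X Z : SemiCubicalSet.{u}) : (X ⊗ Y ⟶ Z) ≃ (X ⟶ homRight Y Z) where
  toFun φ := .mk
    { app := fun a => ↾fun x =>
        { app := fun b => ↾fun y => φ.natTrans.app (a ⊗ b) (mulCubes X Y x y)
          naturality := fun b j g => by
            ext y
            exact (congrArg (fun z => φ.natTrans.app (a ⊗ j) z)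
              (map_mulCubes_right X Y g x y)).symm.trans (natTrans_naturality φ _ _) }
      naturality := fun a i f => by
        ext x
        refine NatTrans.ext (funext fun b => ?_)
        ext y
        exact (congrArg (fun z => φ.natTrans.app (i ⊗ b) z)
          (map_mulCubes_left X Y f x y)).symm.trans (natTrans_naturality φ _ _) }
  invFun ψ := tensorDesc
    (fun a b x y =>
      let χ : Y.functor ⟶ tensorLeft (⟨a⟩ : SemiCube) ⋙ Z.functor := ψ.natTrans.app ⟨a⟩ x
      χ.app ⟨b⟩ y)
    (fun a b i f x y => by
      have := natTrans_naturality ψ f x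
      exact (congrArg (fun φ : Y.functor ⟶ tensorLeft (⟨i⟩ : SemiCube) ⋙ Z.functor =>
        TypeCat.Hom.hom (φ.app ⟨b⟩) y) this).symm)
    (fun a b j g x y => by
      let χ : Y.functor ⟶ tensorLeft (⟨a⟩ : SemiCube) ⋙ Z.functor := ψ.natTrans.app ⟨a⟩ x
      exact (congrArg (fun φ => TypeCat.Hom.hom φ y)
        (χ.naturality (X := ⟨b⟩) (Y := ⟨j⟩) g)).symm)
  left_inv φ := tensor_hom_ext fun a b x y => tensorDesc_mulCubes _ _ _ x y
  right_inv ψ := by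
    refine DayFunctor.hom_ext (NatTrans.ext (funext fun a => ?_))
    ext x
    refine NatTrans.ext (funext fun b => ?_)
    ext y
    exact tensorDesc_mulCubes _ _ _ x y

theorem tensorHom_mulCubes {X X' Y Y' : SemiCubicalSet.{u}} (f : X ⟶ X') (g : Y ⟶ Y') {a b : ℕ}
    (x : X.cubes a) (y : Y.cubes b) :
    (f ⊗ₘ g).natTrans.app ⟨b + a⟩ (mulCubes X Y x y) =
      mulCubes X' Y' (f.natTrans.app ⟨a⟩ x) (g.natTrans.app ⟨b⟩ y) :=
  congrArg (fun φ => TypeCat.Hom.hom φ (Prod.mk x y))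
    (LawfulDayConvolutionMonoidalCategoryStruct.convolutionExtensionUnit_comp_ι_map_tensorHom_app
      SemiCube (Type u) f g ⟨a⟩ ⟨b⟩)

instance (X : SemiCubicalSet.{u}) : (tensorLeft X).IsLeftAdjoint :=
  (Adjunction.adjunctionOfEquivRight (F := tensorLeft X) (fun Y Z => homLeftEquiv X Y Z)
    (fun Y' Y Z f g => by
      refine DayFunctor.hom_ext (NatTrans.ext (funext fun b => ?_))
      ext y
      refine NatTrans.ext (funext fun a => ?_)
      ext x
      refine congrArg (fun z => g.natTrans.app (a ⊗ b) z) ?_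
      refine (congrArg (fun φ : X ⊗ Y' ⟶ X ⊗ Y => φ.natTrans.app (a ⊗ b) (mulCubes X Y' x y))
        (id_tensorHom X f).symm).trans ?_
      exact tensorHom_mulCubes (𝟙 X) f x y)).isLeftAdjoint

instance (Y : SemiCubicalSet.{u}) : (tensorRight Y).IsLeftAdjoint :=
  (Adjunction.adjunctionOfEquivRight (F := tensorRight Y) (fun X Z => homRightEquiv Y X Z)
    (fun X' X Z f g => by
      refine DayFunctor.hom_ext (NatTrans.ext (funext fun a => ?_))
      ext x
      refine NatTrans.ext (funext fun b => ?_)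
      ext y
      refine congrArg (fun z => g.natTrans.app (a ⊗ b) z) ?_
      refine (congrArg (fun φ : X' ⊗ Y ⟶ X ⊗ Y => φ.natTrans.app (a ⊗ b) (mulCubes X' Y x y))
        (tensorHom_id f Y).symm).trans ?_
      exact tensorHom_mulCubes f (𝟙 Y) x y)).isLeftAdjoint

end SemiCubicalSet

/-- If `R` is strong monoidal and `E` is a section of `R`, then the tensor product of the codomain
of `R` is `R (E - ⊗ E -)`. -/
def curriedTensorIsoOfMonoidal {C : Type u₁} [Category.{v₁} C] [MonoidalCategory C]
    {D : Type u₂} [Category.{v₂} D] [MonoidalCategory D] (R : C ⥤ D) [R.Monoidal] (E : D ⥤ C)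
    (i : 𝟭 D ≅ E ⋙ R) :
    curriedTensor D ≅ E ⋙ curriedTensor C ⋙ (Functor.whiskeringLeft _ _ _).obj E ⋙
      (Functor.whiskeringRight _ _ _).obj R :=
  have hi {X Y : D} (f : X ⟶ Y) : f ≫ i.hom.app Y = i.hom.app X ≫ R.map (E.map f) :=
    i.hom.naturality f
  have hid (X : D) : i.hom.app X ≫ 𝟙 (R.obj (E.obj X)) = i.hom.app X := Category.comp_id _
  NatIso.ofComponents
    (fun X => NatIso.ofComponents
      (fun Y => (i.app X ⊗ᵢ i.app Y) ≪≫ Functor.Monoidal.μIso R (E.obj X) (E.obj Y))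
      (fun {Y Y'} f => by
        change X ◁ f ≫ (i.hom.app X ⊗ₘ i.hom.app Y') ≫ Functor.LaxMonoidal.μ R _ _ =
          ((i.hom.app X ⊗ₘ i.hom.app Y) ≫ Functor.LaxMonoidal.μ R _ _) ≫
            R.map (E.obj X ◁ E.map f)
        rw [Category.assoc, ← Functor.LaxMonoidal.μ_natural_right, ← id_tensorHom,
          ← id_tensorHom, tensorHom_comp_tensorHom_assoc, tensorHom_comp_tensorHom_assoc,
          Category.id_comp, hid, hi]))
    (fun {X X'} f => by
      ext Y : 2
      change f ▷ Y ≫ (i.hom.app X' ⊗ₘ i.hom.app Y) ≫ Functor.LaxMonoidal.μ R _ _ =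
        ((i.hom.app X ⊗ₘ i.hom.app Y) ≫ Functor.LaxMonoidal.μ R _ _) ≫
          R.map (E.map f ▷ E.obj Y)
      rw [Category.assoc, ← Functor.LaxMonoidal.μ_natural_left, ← tensorHom_id,
        ← tensorHom_id, tensorHom_comp_tensorHom_assoc, tensorHom_comp_tensorHom_assoc,
        Category.id_comp, hid, hi])

namespace TruncSet

variable (n : ℕ)

/-- The adjunction between extension and restriction. -/
def extendAdjunction : extend.{u} n ⊣ restrict.{u} n :=
  ((TruncSemiCube.incl n).lanAdjunction (Type u)).comp
    (DayFunctor.equiv SemiCube (Type u)).symm.toAdjunction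

instance : (restrict.{u} n).IsLeftAdjoint :=
  ((DayFunctor.equiv SemiCube (Type u)).toAdjunction.comp
    ((TruncSemiCube.incl n).ranAdjunction (Type u))).isLeftAdjoint

instance : IsIso (extendAdjunction.{u} n).unit := by
  let adj := ((TruncSemiCube.incl n).lanAdjunction (Type u)).comp
    (DayFunctor.equiv SemiCube (Type u)).symm.toAdjunction
  have (X : TruncSemiCube n ⥤ Type u) : IsIso (adj.unit.app X) := by
    rw [Adjunction.comp_unit_app]
    infer_instance
  exact NatIso.isIso_of_isIso_app adj.unit

instance : (extend.{u} n).Full :=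
  (extendAdjunction n).fullyFaithfulLOfIsIsoUnit.full

instance : (extend.{u} n).Faithful :=
  (extendAdjunction n).fullyFaithfulLOfIsIsoUnit.faithful

/-- The morphisms of semi-cubical sets which are bijective in dimensions at most `n`. -/
abbrev truncEquivalences : MorphismProperty SemiCubicalSet.{u} :=
  (MorphismProperty.isomorphisms (TruncSet.{u} n)).inverseImage (restrict n)

theorem truncEquivalences_iff {X Y : SemiCubicalSet.{u}} (f : X ⟶ Y) :
    truncEquivalences n f ↔ ∀ k ≤ n, Function.Bijective (f.natTrans.app ⟨k⟩) := by
  have : truncEquivalences n f ↔ ∀ k : TruncSemiCube n,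
      IsIso (f.natTrans.app k.obj) :=
    NatTrans.isIso_iff_isIso_app (C := TruncSemiCube n) (D := Type u) _
  rw [this]
  exact ⟨fun h k hk => (isIso_iff_bijective _).1 (h ⟨⟨k⟩, hk⟩),
    fun h k => (isIso_iff_bijective _).2 (h k.obj.dim k.property)⟩

/-- This is what makes the Day convolution descend to truncated semi-cubical sets. -/
instance : (truncEquivalences.{u} n).IsMonoidal := by
  refine MorphismProperty.IsMonoidal.mk' _ fun f g hf hg => ?_
  rw [truncEquivalences_iff] at hf hg ⊢
  exact fun k hk => SemiCubicalSet.tensorHom_bijective f g (fun i hi => hf i (hi.trans hk))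
    (fun i hi => hg i (hi.trans hk))

/-- The restriction functor has a fully faithful left adjoint, hence it is the localization at the
morphisms which it inverts. -/
instance : (restrict.{u} n).IsLocalization (truncEquivalences n) :=
  (extendAdjunction n).isLocalization'

/-- The monoidal structure on `n`-truncated semi-cubical sets obtained by localizing the Day
convolution at the morphisms which are bijective in dimensions at most `n`. -/
@[reducible]
def monoidal : MonoidalCategory (TruncSet.{u} n) :=
  inferInstanceAs (MonoidalCategory (LocalizedMonoidal (restrict.{u} n) (truncEquivalences n)
    (Iso.refl _)))

attribute [local instance] monoidal

/-- Restriction is strong monoidal. -/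
@[reducible]
def restrictMonoidal : (restrict.{u} n).Monoidal :=
  inferInstanceAs (Localization.Monoidal.toMonoidalCategory (restrict.{u} n) (truncEquivalences n)
    (Iso.refl _)).Monoidal

attribute [local instance] restrictMonoidal

/-- The unit of the coreflection of semi-cubical sets onto truncated ones. -/
def unitIso : 𝟭 (TruncSet.{u} n) ≅ extend n ⋙ restrict n :=
  asIso (extendAdjunction n).unit

/-- The tensor product of truncated semi-cubical sets is the truncation of the Day convolution of
their extensions. -/
def curriedTensorIso : curriedTensor (TruncSet.{u} n) ≅ dayTensor n :=
  curriedTensorIsoOfMonoidal (restrict.{u} n) (extend n) (unitIso n)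

instance (X : TruncSet.{u} n) : PreservesColimits (tensorLeft X) :=
  have : (extend.{u} n).IsLeftAdjoint := (extendAdjunction n).isLeftAdjoint
  preservesColimits_of_natIso (F := extend n ⋙ tensorLeft ((extend n).obj X) ⋙ restrict n)
    ((curriedTensorIso n).symm.app X)

instance (Y : TruncSet.{u} n) : PreservesColimits (tensorRight Y) :=
  have : (extend.{u} n).IsLeftAdjoint := (extendAdjunction n).isLeftAdjoint
  preservesColimits_of_natIso (F := extend n ⋙ tensorRight ((extend n).obj Y) ⋙ restrict n)
    (((flipFunctor _ _ _).mapIso (curriedTensorIso n)).symm.app Y)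

/-- A truncated semi-cubical set is finite if it has finitely many cubes in each dimension. -/
def IsFinite {n : ℕ} (X : TruncSet.{u} n) : Prop :=
  ∀ k : TruncSemiCube n, Finite (Functor.obj (C := TruncSemiCube n) (D := Type u) X k)

variable {n}

theorem IsFinite.of_iso {X Y : TruncSet.{u} n} (hX : X.IsFinite) (e : X ≅ Y) : Y.IsFinite :=
  fun k =>
    have := hX k
    Finite.of_equiv _ (Iso.toEquiv (Iso.app (C := TruncSemiCube n) (D := Type u) e k))

theorem isFinite_restrict {X : SemiCubicalSet.{u}} (hX : ∀ k ≤ n, Finite (X.cubes k)) :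
    ((restrict n).obj X).IsFinite :=
  fun k => hX k.obj.dim k.property

theorem IsFinite.extend {X : TruncSet.{u} n} (hX : X.IsFinite) :
    ∀ k ≤ n, Finite (((TruncSet.extend n).obj X).cubes k) :=
  fun k hk => (hX.of_iso ((unitIso n).app X)) ⟨⟨k⟩, hk⟩

theorem IsFinite.tensor {X Y : TruncSet.{u} n} (hX : X.IsFinite) (hY : Y.IsFinite) :
    (X ⊗ Y).IsFinite :=
  (isFinite_restrict fun _ hk => SemiCubicalSet.finite_cubes_tensor _ _
    (fun i hi => hX.extend i (hi.trans hk)) (fun i hi => hY.extend i (hi.trans hk))).of_iso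
      (((curriedTensorIso n).symm.app X).app Y)

/-- A truncated semi-cubical set with one cube in dimension zero and no others is isomorphic to
the unit. -/
theorem nonempty_iso_unit (X : TruncSemiCube n ⥤ Type u)
    (h₀ : Nonempty (X.obj (TruncSemiCube.point n)))
    (h₁ : ∀ k, Subsingleton (X.obj k)) (h₂ : ∀ k, k.obj.dim ≠ 0 → IsEmpty (X.obj k)) :
    Nonempty ((X : TruncSet.{u} n) ≅ 𝟙_ (TruncSet.{u} n)) := by
  let U : TruncSemiCube n ⥤ Type u := (restrict n).obj (𝟙_ SemiCubicalSet.{u})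
  have hU₁ (k) : Subsingleton (U.obj k) := SemiCubicalSet.subsingleton_unit_cubes k.obj.dim
  have hU₂ (k : TruncSemiCube n) (hk : k.obj.dim ≠ 0) : IsEmpty (U.obj k) := by
    obtain ⟨⟨_ | k⟩, hk'⟩ := k
    · exact (hk rfl).elim
    · exact SemiCubicalSet.isEmpty_unit_cubes k
  have hU₀ : Nonempty (U.obj (TruncSemiCube.point n)) := SemiCubicalSet.nonempty_unit_cubes
  have e (k) : Nonempty (X.obj k ≃ U.obj k) := by
    by_cases hk : k.obj.dim = 0
    · obtain rfl : k = TruncSemiCube.point n := ObjectProperty.FullSubcategory.ext (SemiCube.ext hk)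
      have := h₁ (TruncSemiCube.point n)
      have := hU₁ (TruncSemiCube.point n)
      exact ⟨equivOfSubsingletonOfSubsingleton (fun _ => hU₀.some) (fun _ => h₀.some)⟩
    · have := h₂ k hk
      have := hU₂ k hk
      exact ⟨Equiv.equivOfIsEmpty _ _⟩
  have i : X ≅ U := NatIso.ofComponents (fun k => (e k).some.toIso)
    (fun {k l} f => by
      ext x
      exact (hU₁ l).elim _ _)
  exact ⟨i ≪≫ (Functor.Monoidal.εIso (restrict.{u} n)).symm⟩

theorem isFinite_unit : (𝟙_ (TruncSet.{u} n)).IsFinite :=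
  IsFinite.of_iso (X := (restrict n).obj (𝟙_ SemiCubicalSet.{u}))
    (isFinite_restrict (X := 𝟙_ SemiCubicalSet.{u}) fun k _ =>
      have := SemiCubicalSet.subsingleton_unit_cubes.{u} k
      inferInstance)
    (Functor.Monoidal.εIso (restrict.{u} n)).symm

end TruncSet

end

/-! ### Completion under finite limits -/

noncomputable section

section FiniteShapes

variable (J : Type u₃) [Category.{v₃} J] [Finite J] [∀ a b : J, Finite (a ⟶ b)]

/-- A category with finitely many objects and morphisms is equivalent to a finite category in the
lowest universe. -/
theorem exists_finCategory_equivalence :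
    ∃ (J₀ : Type) (_ : SmallCategory J₀) (_ : FinCategory J₀), Nonempty (J₀ ≌ J) := by
  have : LocallySmall.{0} J := ⟨fun a b => inferInstance⟩
  have : Small.{0} (ShrinkHoms.{u₃} J) := inferInstanceAs (Small.{0} J)
  have : Finite (ShrinkHoms.{u₃} J) := inferInstanceAs (Finite J)
  let J₀ := Shrink.{0} (ShrinkHoms.{u₃} J)
  let e : J ≌ J₀ := (ShrinkHoms.equivalence.{0} J).trans (Shrink.equivalence _)
  have : Finite J₀ := Finite.of_equiv _ (equivShrink (ShrinkHoms.{u₃} J))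
  have (a b : J₀) : Finite (a ⟶ b) :=
    Finite.of_injective (fun f => e.inverse.map f) e.inverse.map_injective
  exact ⟨J₀, inferInstance, { fintypeObj := Fintype.ofFinite _
                              fintypeHom := fun _ _ => Fintype.ofFinite _ }, ⟨e.symm⟩⟩

theorem hasLimitsOfShape_of_finite (E : Type u₁) [Category.{v₁} E] [HasFiniteLimits E] :
    HasLimitsOfShape J E := by
  obtain ⟨J₀, _, _, ⟨e⟩⟩ := exists_finCategory_equivalence J
  exact hasLimitsOfShape_of_equivalence e

theorem preservesLimitsOfShape_of_finite {L : Type u₂} [Category.{v₂} L] {E : Type u₁}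
    [Category.{v₁} E] (F : L ⥤ E) [PreservesFiniteLimits F] : PreservesLimitsOfShape J F := by
  obtain ⟨J₀, _, _, ⟨e⟩⟩ := exists_finCategory_equivalence J
  exact preservesLimitsOfShape_of_equiv e F

end FiniteShapes

section Restriction

variable {K : Type u} [Category.{v} K] {L : Type u₂} [Category.{v₂} L] (j : K ⥤ L)

/-- The canonical cone of objects `j k` under `X`. -/
@[simps]
def canonicalCone (X : L) : Cone (StructuredArrow.proj X j ⋙ j) where
  pt := X
  π := { app := fun g => g.hom
         naturality := fun _ _ f => (Category.id_comp _).trans (StructuredArrow.w f).symm }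

/-- A functor `j : K ⥤ L` making `L` behave as the category of formal finite limits of objects of
`K`. -/
structure IsFiniteLimitCompletion : Prop where
  hasFiniteLimits : HasFiniteLimits L
  full : j.Full
  faithful : j.Faithful
  finite_obj (X : L) : Finite (StructuredArrow X j)
  finite_hom (X : L) (g g' : StructuredArrow X j) : Finite (g ⟶ g')
  /-- Every object is canonically a limit of objects in the image of `j`. -/
  codense (X : L) : Nonempty (IsLimit (canonicalCone j X))
  /-- Morphisms from a finite limit into an object in the image of `j` form the colimit of the
  morphisms from the terms of the diagram. -/
  preserves (k : K) : PreservesFiniteLimits (yoneda.obj (j.obj k)).rightOp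

namespace IsFiniteLimitCompletion

variable {j} (hj : IsFiniteLimitCompletion j) {E : Type u₁} [Category.{v₁} E]

include hj

/-- Finite limit preserving functors are right Kan extensions of their restrictions. -/
theorem isRightKanExtension (F : L ⥤ E) [PreservesFiniteLimits F] :
    F.IsRightKanExtension (𝟙 (j ⋙ F)) := by
  refine Functor.RightExtension.IsPointwiseRightKanExtension.isRightKanExtension
    (E := Functor.RightExtension.mk F (𝟙 (j ⋙ F))) fun X => ?_
  have := hj.finite_obj X
  have := hj.finite_hom X
  have := preservesLimitsOfShape_of_finite (StructuredArrow X j) F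
  refine (isLimitOfPreserves F (hj.codense X).some).ofIsoLimit (Cone.ext (Iso.refl _) fun g => ?_)
  exact (Category.comp_id _).symm.trans (Category.id_comp _).symm

theorem hasPointwiseRightKanExtension [HasFiniteLimits E] (G : K ⥤ E) :
    j.HasPointwiseRightKanExtension G := fun X => by
  have := hj.finite_obj X
  have := hj.finite_hom X
  have := hasLimitsOfShape_of_finite (StructuredArrow X j) E
  change HasLimit _
  infer_instance

/-- Pointwise right Kan extensions along `j` preserve finite limits, as morphisms from a finite
limit to `j k` all come from a term of the diagram. -/
theorem preservesFiniteLimits (G : K ⥤ E) (R : L ⥤ E) (α : j ⋙ R ⟶ G)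
    (hR : (Functor.RightExtension.mk R α).IsPointwiseRightKanExtension) :
    PreservesFiniteLimits R := by
  refine ⟨fun J _ _ => ⟨fun {F} => ⟨fun {c} hc => ?_⟩⟩⟩
  have hcol (k : K) : IsColimit ((yoneda.obj (j.obj k)).mapCocone c.op) :=
    have := hj.preserves k
    have := preservesFiniteColimits_of_rightOp (yoneda.obj (j.obj k))
    isColimitOfPreserves (yoneda.obj (j.obj k)) hc.op
  have hcol' (k : K) := (Types.isColimit_iff_coconeTypesIsColimit _).1 ⟨hcol k⟩
  let T (s : Cone (F ⋙ R)) (k : K) : (F.op ⋙ yoneda.obj (j.obj k)).CoconeTypes :=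
    { pt := s.pt ⟶ G.obj k
      ι := fun i y => s.π.app i.unop ≫ R.map y ≫ α.app k
      ι_naturality := fun {i i'} f => by
        ext y
        dsimp
        rw [R.map_comp, Category.assoc]
        exact s.w_assoc f.unop _ }
  let d (s : Cone (F ⋙ R)) (k : K) (x : c.pt ⟶ j.obj k) : s.pt ⟶ G.obj k := (hcol' k).desc (T s k) x
  have hd (s : Cone (F ⋙ R)) (k : K) (i : J) (y : F.obj i ⟶ j.obj k) :
      d s k (c.π.app i ≫ y) = s.π.app i ≫ R.map y ≫ α.app k :=
    (hcol' k).fac_apply (T s k) (Opposite.op i) y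
  have hsurj (k : K) (x : c.pt ⟶ j.obj k) : ∃ i y, c.π.app i ≫ y = x := by
    obtain ⟨i, y, h⟩ := (hcol' k).ι_jointly_surjective x
    exact ⟨i.unop, y, h⟩
  have hR_ext {X : L} {e : E} {f g : e ⟶ R.obj X}
      (h : ∀ (k : K) (x : X ⟶ j.obj k), f ≫ R.map x ≫ α.app k = g ≫ R.map x ≫ α.app k) : f = g :=
    (hR X).hom_ext fun g => h g.right g.hom
  let l (s : Cone (F ⋙ R)) : s.pt ⟶ R.obj c.pt := (hR c.pt).lift
    { pt := s.pt
      π :=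
        { app := fun g => d s g.right g.hom
          naturality := fun g g' f => by
            obtain ⟨i, y, hy⟩ := hsurj _ g.hom
            have hy' : c.π.app i ≫ y ≫ j.map f.right = g'.hom := by
              rw [reassoc_of% hy]; exact StructuredArrow.w f
            change 𝟙 _ ≫ d s g'.right g'.hom = d s g.right g.hom ≫ G.map f.right
            rw [← hy, ← hy', Category.id_comp, hd, hd]
            have := α.naturality f.right
            dsimp at this
            rw [R.map_comp, Category.assoc, Category.assoc, Category.assoc, this] } }
  have hl (s : Cone (F ⋙ R)) (k : K) (x : c.pt ⟶ j.obj k) :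
      l s ≫ R.map x ≫ α.app k = d s k x :=
    (hR c.pt).fac _ (StructuredArrow.mk x)
  refine ⟨⟨l, fun s i => hR_ext fun k x => ?_, fun s m hm => hR_ext fun k x => ?_⟩⟩
  · change (l s ≫ R.map (c.π.app i)) ≫ _ = _
    rw [Category.assoc, ← R.map_comp_assoc, hl, hd]
  · obtain ⟨i, y, rfl⟩ := hsurj k x
    have := hm i
    dsimp at this
    rw [hl, hd, R.map_comp_assoc, reassoc_of% this]

/-- The universal property of the finite limit completion, for target categories in all
universes. -/
theorem isEquivalence (E : Type u₁) [Category.{v₁} E] [HasFiniteLimits E] :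
    (LeftExactFunctor.forget L E ⋙ (Functor.whiskeringLeft K L E).obj j).IsEquivalence where
  faithful := ⟨fun {F F'} f g h => by
    have := F'.property
    have := hj.isRightKanExtension F'.obj
    refine (ObjectProperty.hom_ext _ (Functor.hom_ext_of_isRightKanExtension F'.obj
      (𝟙 (j ⋙ F'.obj)) _ _ ?_))
    exact congrArg (· ≫ 𝟙 _) h⟩
  full := ⟨fun {F F'} f => by
    have := F'.property
    have := hj.isRightKanExtension F'.obj
    refine ⟨ObjectProperty.homMk (F'.obj.liftOfIsRightKanExtension (𝟙 (j ⋙ F'.obj)) _ f), ?_⟩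
    exact (Category.comp_id _).symm.trans
      (F'.obj.liftOfIsRightKanExtension_fac (𝟙 (j ⋙ F'.obj)) _ f)⟩
  essSurj := ⟨fun G => by
    have := hj.full
    have := hj.faithful
    have := hj.hasPointwiseRightKanExtension G
    have hR := j.pointwiseRightKanExtensionIsPointwiseRightKanExtension G
    have := hj.preservesFiniteLimits G _ _ hR
    have : IsIso (j.pointwiseRightKanExtensionCounit G) := hR.isIso_hom
    let i : j ⋙ j.pointwiseRightKanExtension G ≅ G := asIso (j.pointwiseRightKanExtensionCounit G)
    exact ⟨LeftExactFunctor.of (j.pointwiseRightKanExtension G), ⟨i⟩⟩⟩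

end IsFiniteLimitCompletion

/-- Two categories with the universal property of the free category with finite limits are
equivalent. -/
theorem exists_equivalence_of_isEquivalence {L' : Type u₂} [Category.{v₂} L'] (j' : K ⥤ L')
    [HasFiniteLimits L] [HasFiniteLimits L']
    (h : ∀ (E : Type u₂) [Category.{v₂} E] [HasFiniteLimits E],
      (LeftExactFunctor.forget L E ⋙ (Functor.whiskeringLeft K L E).obj j).IsEquivalence)
    (h' : ∀ (E : Type u₂) [Category.{v₂} E] [HasFiniteLimits E],
      (LeftExactFunctor.forget L' E ⋙ (Functor.whiskeringLeft K L' E).obj j').IsEquivalence) :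
    ∃ e : L ≌ L', Nonempty (j ⋙ e.functor ≅ j') := by
  have := h L
  have := h L'
  have := h' L
  have := h' L'
  let r (E : Type u₂) [Category.{v₂} E] := LeftExactFunctor.forget L E ⋙
    (Functor.whiskeringLeft K L E).obj j
  let r' (E : Type u₂) [Category.{v₂} E] := LeftExactFunctor.forget L' E ⋙
    (Functor.whiskeringLeft K L' E).obj j'
  let F : L ⥤ₗ L' := (r L').objPreimage j'
  let F' : L' ⥤ₗ L := (r' L).objPreimage j
  have iF : j ⋙ F.obj ≅ j' := (r L').objObjPreimageIso j'
  have iF' : j' ⋙ F'.obj ≅ j := (r' L).objObjPreimageIso j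
  have := F.property
  have := F'.property
  have : PreservesFiniteLimits (F.obj ⋙ F'.obj) := comp_preservesFiniteLimits _ _
  have : PreservesFiniteLimits (F'.obj ⋙ F.obj) := comp_preservesFiniteLimits _ _
  have η : LeftExactFunctor.of (𝟭 L) ≅ LeftExactFunctor.of (F.obj ⋙ F'.obj) :=
    (r L).preimageIso
      (j.rightUnitor ≪≫ iF'.symm ≪≫ Functor.isoWhiskerRight iF.symm F'.obj ≪≫
        Functor.associator _ _ _)
  have ε : LeftExactFunctor.of (F'.obj ⋙ F.obj) ≅ LeftExactFunctor.of (𝟭 L') :=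
    (r' L').preimageIso
      ((Functor.associator _ _ _).symm ≪≫ Functor.isoWhiskerRight iF' F.obj ≪≫ iF ≪≫
        j'.rightUnitor.symm)
  exact ⟨CategoryTheory.Equivalence.mk F.obj F'.obj ((LeftExactFunctor.forget L L).mapIso η)
    ((LeftExactFunctor.forget L' L').mapIso ε), ⟨iF⟩⟩

end Restriction

end

/-! ### Functors to finite sets -/

noncomputable section

section FiniteModel

variable {K : Type} [SmallCategory K] {L : Type u} [SmallCategory L]

/-- The functor `X ↦ Hom_L (X, j -)`. -/
abbrev homInto (j : K ⥤ L) : L ⥤ (K ⥤ Type u)ᵒᵖ :=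
  (coyoneda ⋙ (Functor.whiskeringLeft K L (Type u)).obj j).rightOp

/-- `j : K ⥤ L` identifies `L` with the opposite of the category of functors from `K` to finite
sets, and `j` with the Yoneda embedding. -/
def IsFiniteModel (j : K ⥤ L) : Prop :=
  ∃ I : L ⥤ (K ⥤ Type u)ᵒᵖ, I.Full ∧ I.Faithful ∧
    Nonempty (j ⋙ I ≅ (uliftCoyoneda.{u} (C := K)).rightOp) ∧
    ∀ Y : K ⥤ Type u, I.essImage (Opposite.op Y) ↔ ∀ k, Finite (Y.obj k)

section

variable {j : K ⥤ L} {I : L ⥤ (K ⥤ Type u)ᵒᵖ} (hI : I.FullyFaithful)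
  (i : j ⋙ I ≅ (uliftCoyoneda.{u} (C := K)).rightOp)

/-- The bijection between `Hom_L (X, j k)` and `I X` evaluated at `k`, by Yoneda. -/
def homIntoEquiv (X : L) (k : K) : (X ⟶ j.obj k) ≃ (I.obj X).unop.obj k :=
  hI.homEquiv.trans ((i.app k).homToEquiv.trans ((opEquiv _ _).trans uliftCoyonedaEquiv))

theorem homIntoEquiv_apply {X : L} {k : K} (x : X ⟶ j.obj k) :
    homIntoEquiv hI i X k x = uliftCoyonedaEquiv (I.map x ≫ i.hom.app k).unop := rfl

theorem map_homIntoEquiv (X : L) {k l : K} (f : k ⟶ l) (x : X ⟶ j.obj k) :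
    (I.obj X).unop.map f (homIntoEquiv hI i X k x) = homIntoEquiv hI i X l (x ≫ j.map f) := by
  rw [homIntoEquiv_apply, homIntoEquiv_apply]
  refine (uliftCoyonedaEquiv_naturality _ f).trans (congrArg uliftCoyonedaEquiv ?_)
  have : I.map (j.map f) ≫ i.hom.app l = i.hom.app k ≫ (uliftCoyoneda.{u}.map f.op).op :=
    i.hom.naturality f
  rw [I.map_comp, Category.assoc, this]
  rfl

theorem app_homIntoEquiv {X Y : L} (g : X ⟶ Y) (k : K) (y : Y ⟶ j.obj k) :
    (I.map g).unop.app k (homIntoEquiv hI i Y k y) = homIntoEquiv hI i X k (g ≫ y) := by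
  rw [homIntoEquiv_apply, homIntoEquiv_apply]
  refine (uliftCoyonedaEquiv_comp _ _).symm.trans (congrArg uliftCoyonedaEquiv ?_)
  rw [I.map_comp, Category.assoc]
  rfl

/-- If a fully faithful functor `I` to `(K ⥤ Type u)ᵒᵖ` extends the Yoneda embedding along `j`, then
`I X` is `Hom_L (X, j -)`. -/
def homIntoIso : homInto j ≅ I :=
  Iso.symm <| NatIso.ofComponents
    (fun X => Iso.op (X := ((homInto j).obj X).unop)
      (NatIso.ofComponents (fun k => (homIntoEquiv hI i X k).toIso)
        (fun {k l} f => by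
          ext x
          exact (map_homIntoEquiv hI i X f x).symm)))
    (fun {X Y} g => by
      refine Quiver.Hom.unop_inj (NatTrans.ext (funext fun k => ?_))
      ext y
      exact app_homIntoEquiv hI i g k y)

end

/-- The embedding of functors to the skeleton of finite sets into all functors. -/
abbrev finiteFunctorsIncl (K : Type) [SmallCategory K] :
    (K ⥤ FintypeCat.Skeleton.{u})ᵒᵖ ⥤ (K ⥤ Type u)ᵒᵖ :=
  ((Functor.whiskeringRight K _ _).obj (FintypeCat.Skeleton.incl ⋙ FintypeCat.incl)).op

theorem essImage_finiteFunctorsIncl (Y : K ⥤ Type u) :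
    (finiteFunctorsIncl.{u} K).essImage (Opposite.op Y) ↔ ∀ k, Finite (Y.obj k) := by
  constructor
  · rintro ⟨X, ⟨e⟩⟩ k
    let e' := e.unop.app k
    exact Finite.of_equiv (ULift (Fin (X.unop.obj k).len)) e'.symm.toEquiv
  · intro h
    have hY (k : K) : (FintypeCat.Skeleton.incl ⋙ FintypeCat.incl).essImage (Y.obj k) := by
      have := Fintype.ofFinite (Y.obj k)
      let Z := FintypeCat.of (Y.obj k)
      exact ⟨_, ⟨FintypeCat.incl.mapIso (FintypeCat.Skeleton.incl.objObjPreimageIso Z)⟩⟩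
    exact ⟨_, ⟨(Functor.essImage.liftFunctorCompIso Y _ hY).symm.op⟩⟩

/-- The opposite of the category of functors from `K` to a skeleton of the category of finite sets,
which is small. -/
theorem exists_isFiniteModel (K : Type) [SmallCategory K] [∀ a b : K, Finite (a ⟶ b)] :
    ∃ (L : Type u) (_ : SmallCategory L) (j : K ⥤ L), IsFiniteModel j := by
  have hJ (k : K) : (finiteFunctorsIncl.{u} K).essImage ((uliftCoyoneda.{u}).rightOp.obj k) :=
    (essImage_finiteFunctorsIncl _).2 fun l => inferInstanceAs (Finite (ULift (k ⟶ l)))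
  exact ⟨_, _, Functor.essImage.liftFunctor _ (finiteFunctorsIncl.{u} K) hJ,
    finiteFunctorsIncl.{u} K, inferInstance, inferInstance,
    ⟨Functor.essImage.liftFunctorCompIso _ _ hJ⟩, essImage_finiteFunctorsIncl⟩

namespace IsFiniteModel

theorem of_equivalence {L' : Type u} [SmallCategory L'] {j : K ⥤ L} {j' : K ⥤ L'}
    (hj' : IsFiniteModel j') (e : L ≌ L') (i : j ⋙ e.functor ≅ j') : IsFiniteModel j := by
  obtain ⟨I, _, _, ⟨i'⟩, hI⟩ := hj'
  exact ⟨e.functor ⋙ I, inferInstance, inferInstance,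
    ⟨(Functor.associator _ _ _).symm ≪≫ Functor.isoWhiskerRight i I ≪≫ i'⟩,
    fun Y => by rw [← hI Y, Functor.essImage_comp_of_essSurj]⟩

variable {j : K ⥤ L} (hj : IsFiniteModel j)

include hj

theorem full : j.Full := by
  obtain ⟨I, _, _, ⟨i⟩, hI⟩ := hj
  exact Functor.Full.of_comp_faithful_iso i

theorem faithful : j.Faithful := by
  obtain ⟨I, _, _, ⟨i⟩, hI⟩ := hj
  exact Functor.Faithful.of_comp_iso i

theorem full_homInto : (homInto j).Full := by
  obtain ⟨I, _, _, ⟨i⟩, hI⟩ := hj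
  exact Functor.Full.of_iso (homIntoIso (.ofFullyFaithful I) i).symm

theorem faithful_homInto : (homInto j).Faithful := by
  obtain ⟨I, _, _, ⟨i⟩, hI⟩ := hj
  exact Functor.Faithful.of_iso (homIntoIso (.ofFullyFaithful I) i).symm

theorem essImage_iff (Y : K ⥤ Type u) :
    (homInto j).essImage (Opposite.op Y) ↔ ∀ k, Finite (Y.obj k) := by
  obtain ⟨I, _, _, ⟨i⟩, hI⟩ := hj
  rw [← hI Y, Functor.essImage_eq_of_natIso (homIntoIso (.ofFullyFaithful I) i)]

theorem finite_hom (X : L) (k : K) : Finite (X ⟶ j.obj k) :=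
  (hj.essImage_iff _).1 ((homInto j).obj_mem_essImage X) k

/-- Finite limits of objects of `L` can be computed in `(K ⥤ Type u)ᵒᵖ`, since a finite colimit of
finite sets is finite. -/
theorem createsLimit {J : Type} [SmallCategory J] [FinCategory J] (F : J ⥤ L) :
    Nonempty (CreatesLimit F (homInto j)) := by
  have := hj.full_homInto
  have := hj.faithful_homInto
  have hc := limit.isLimit (F ⋙ homInto j)
  have : (homInto j).essImage (limit (F ⋙ homInto j)) := by
    refine (hj.essImage_iff (limit (F ⋙ homInto j)).unop).2 fun k => ?_
    have hk := isColimitOfPreserves ((evaluation K (Type u)).obj k)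
      (isColimitCoconeLeftOpOfCone _ hc)
    have (x : Jᵒᵖ) : Finite ((((F ⋙ homInto j).leftOp ⋙ (evaluation K (Type u)).obj k)).obj x) :=
      hj.finite_hom _ _
    let c := ((evaluation K (Type u)).obj k).mapCocone (coconeLeftOpOfCone
      (limit.cone (F ⋙ homInto j)))
    refine Finite.of_surjective (α := Σ x : Jᵒᵖ,
      (((F ⋙ homInto j).leftOp ⋙ (evaluation K (Type u)).obj k)).obj x)
      (fun p => c.ι.app p.1 p.2) fun y => ?_
    obtain ⟨x, z, h⟩ := Types.jointly_surjective_of_isColimit hk y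
    exact ⟨⟨x, z⟩, h⟩
  exact ⟨createsLimitOfFullyFaithfulOfIso' hc _ this.getIso⟩

theorem hasFiniteLimits : HasFiniteLimits L := by
  refine ⟨fun J _ _ => ⟨fun F => ?_⟩⟩
  have := (hj.createsLimit F).some
  exact hasLimit_of_created F (homInto j)

theorem preservesFiniteLimits_homInto : PreservesFiniteLimits (homInto j) := by
  refine ⟨fun J _ _ => ⟨fun {F} => ?_⟩⟩
  have := (hj.createsLimit F).some
  infer_instance

/-- Codensity of `j`: a natural transformation `Hom_L (X, j -) ⟶ Hom_L (T, j -)` comes from a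
morphism `T ⟶ X`. -/
theorem codense (X : L) : Nonempty (IsLimit (canonicalCone j X)) := by
  have := hj.full_homInto
  have := hj.faithful_homInto
  let φ (s : Cone (StructuredArrow.proj X j ⋙ j)) : (homInto j).obj s.pt ⟶ (homInto j).obj X :=
    Quiver.Hom.op
      { app := fun k => ↾fun x => s.π.app (StructuredArrow.mk x)
        naturality := fun k l f => by
          ext x
          exact (s.w (StructuredArrow.homMk f :
            StructuredArrow.mk x ⟶ StructuredArrow.mk (x ≫ j.map f))).symm }
  have hφ (s) (g : StructuredArrow X j) : (homInto j).preimage (φ s) ≫ g.hom = s.π.app g := by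
    have := congrArg (fun f => TypeCat.Hom.hom (f.unop.app g.right) g.hom)
      ((homInto j).map_preimage (φ s))
    exact this
  refine ⟨⟨fun s => (homInto j).preimage (φ s), hφ, fun s m hm => ?_⟩⟩
  refine (homInto j).map_injective (Quiver.Hom.unop_inj (NatTrans.ext (funext fun k => ?_)))
  ext x
  exact (hm (StructuredArrow.mk x)).trans (hφ s (StructuredArrow.mk x)).symm

theorem isFiniteLimitCompletion [Finite K] [∀ a b : K, Finite (a ⟶ b)] :
    IsFiniteLimitCompletion j where
  hasFiniteLimits := hj.hasFiniteLimits
  full := hj.full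
  faithful := hj.faithful
  finite_obj X := by
    have := hj.finite_hom X
    exact Finite.of_injective (β := Σ k : K, (X ⟶ j.obj k)) (fun g => ⟨g.right, g.hom⟩)
      fun g g' h => by
        obtain ⟨⟨⟨⟩⟩, k, x⟩ := g
        obtain ⟨⟨⟨⟩⟩, k', x'⟩ := g'
        cases h
        rfl
  finite_hom X g g' := Finite.of_injective (β := g.right ⟶ g'.right) (fun f => f.right)
    fun f f' h => StructuredArrow.hom_ext _ _ h
  codense := hj.codense
  preserves k :=
    have := hj.preservesFiniteLimits_homInto
    have := comp_preservesFiniteLimits (homInto j) ((evaluation K (Type u)).obj k).op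
    preservesFiniteLimits_of_natIso (F := homInto j ⋙ ((evaluation K (Type u)).obj k).op)
      (NatIso.ofComponents fun _ => Iso.refl _)

end IsFiniteModel

/-- The free lex category on `K` is the opposite of the category of functors from `K` to finite
sets. Since one such model exists and has the universal property, every free lex category is
equivalent to it. -/
theorem isFreeLex_iff_isFiniteModel [Finite K] [∀ a b : K, Finite (a ⟶ b)] {j : K ⥤ L} :
    IsFreeLex j ↔ IsFiniteModel j := by
  constructor
  · intro h
    obtain ⟨L', _, j', hj'⟩ := exists_isFiniteModel.{u} K
    have := h.hasFiniteLimits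
    have := hj'.hasFiniteLimits
    obtain ⟨e, ⟨i⟩⟩ := exists_equivalence_of_isEquivalence j j' (fun E _ _ => h.isEquivalence E)
      (fun E _ _ => hj'.isFiniteLimitCompletion.isEquivalence E)
    exact hj'.of_equivalence e i
  · exact fun h => ⟨h.hasFiniteLimits, fun E _ _ => h.isFiniteLimitCompletion.isEquivalence E⟩

end FiniteModel

end

/-! ### The monoidal structure on the free lex category -/

noncomputable section

/-- A monoidal structure restricts along a fully faithful functor whose essential image contains
the unit and is closed under tensor products. -/
theorem exists_monoidal_of_fullyFaithful {L : Type u} [Category.{v} L] {M : Type u₁}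
    [Category.{v₁} M] [MonoidalCategory M] (N : L ⥤ M) [N.Full] [N.Faithful]
    (hunit : N.essImage (𝟙_ M)) (htensor : ∀ X Y : L, N.essImage (N.obj X ⊗ N.obj Y)) :
    ∃ _ : MonoidalCategory L, Nonempty N.Monoidal := by
  let t (X Y : L) : L := (htensor X Y).witness
  let μ (X Y : L) : N.obj X ⊗ N.obj Y ≅ N.obj (t X Y) := (htensor X Y).getIso.symm
  let ε : 𝟙_ M ≅ N.obj hunit.witness := hunit.getIso.symm
  let S : MonoidalCategoryStruct L :=
    { tensorObj := t
      whiskerLeft := fun X _ _ f => N.preimage ((μ _ _).inv ≫ (N.obj X ◁ N.map f) ≫ (μ _ _).hom)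
      whiskerRight := fun f Y => N.preimage ((μ _ _).inv ≫ (N.map f ▷ N.obj Y) ≫ (μ _ _).hom)
      tensorHom := fun f g => N.preimage ((μ _ _).inv ≫ (N.map f ⊗ₘ N.map g) ≫ (μ _ _).hom)
      tensorUnit := hunit.witness
      associator := fun X Y Z => N.preimageIso
        ((((μ _ _).symm ≪≫ ((μ _ _).symm ⊗ᵢ .refl _)) ≪≫ α_ (N.obj X) (N.obj Y) (N.obj Z)
          ≪≫ ((.refl _ ⊗ᵢ μ _ _) ≪≫ μ _ _)))
      leftUnitor := fun X => N.preimageIso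
        (((μ _ _).symm ≪≫ (ε.symm ⊗ᵢ .refl _)) ≪≫ λ_ (N.obj X))
      rightUnitor := fun X => N.preimageIso
        (((μ _ _).symm ≪≫ (.refl _ ⊗ᵢ ε.symm)) ≪≫ ρ_ (N.obj X)) }
  let d : Monoidal.InducingFunctorData N :=
    { μIso := μ
      εIso := ε
      whiskerLeft_eq := fun _ _ _ _ => N.map_preimage _
      whiskerRight_eq := fun _ _ => N.map_preimage _
      tensorHom_eq := fun _ _ => N.map_preimage _
      associator_eq := fun _ _ _ => N.map_preimage _
      leftUnitor_eq := fun _ => N.map_preimage _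
      rightUnitor_eq := fun _ => N.map_preimage _ }
  exact ⟨Monoidal.induced N d, ⟨Monoidal.fromInducedMonoidal N d⟩⟩

/-- A monoidal structure is lex if it is compatible with a fully faithful lex functor to a monoidal
category with lex tensor products. -/
theorem isLexMonoidal_of_fullyFaithful {L : Type u} [Category.{v} L] [MonoidalCategory L]
    [HasFiniteLimits L] {M : Type u₁} [Category.{v₁} M] [MonoidalCategory M] (N : L ⥤ M) [N.Full]
    [N.Faithful] [N.Monoidal] [PreservesFiniteLimits N]
    (hl : ∀ X : M, PreservesFiniteLimits (tensorLeft X))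
    (hr : ∀ X : M, PreservesFiniteLimits (tensorRight X)) : IsLexMonoidal L where
  hasFiniteLimits := inferInstance
  tensorLeft_lex X := by
    have := comp_preservesFiniteLimits N (tensorLeft (N.obj X))
    have : PreservesFiniteLimits (tensorLeft X ⋙ N) :=
      preservesFiniteLimits_of_natIso (Functor.Monoidal.commTensorLeft N X)
    exact preservesFiniteLimits_of_reflects_of_preserves (tensorLeft X) N
  tensorRight_lex X := by
    have := comp_preservesFiniteLimits N (tensorRight (N.obj X))
    have : PreservesFiniteLimits (tensorRight X ⋙ N) :=
      preservesFiniteLimits_of_natIso (Functor.Monoidal.commTensorRight N X)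
    exact preservesFiniteLimits_of_reflects_of_preserves (tensorRight X) N

theorem SemiCube.Word.eq_of_zero {k : ℕ} (f g : Word 0 k) : f = g := by
  cases f
  cases g
  rfl

instance SemiCube.finite_hom (X Y : SemiCube) : Finite (X ⟶ Y) := Word.finite X.dim Y.dim

namespace TruncSemiCube

variable (n : ℕ)

instance : Finite (TruncSemiCube n) :=
  Finite.of_injective (β := Fin (n + 1)) (fun k => ⟨k.obj.dim, Nat.lt_succ_of_le k.property⟩)
    fun _ _ h => ObjectProperty.FullSubcategory.ext (SemiCube.ext (congrArg Fin.val h))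

instance (k l : TruncSemiCube n) : Finite (k ⟶ l) :=
  Finite.of_injective _ (incl n).map_injective

end TruncSemiCube

namespace TruncSet

attribute [local instance] monoidal

variable {n : ℕ}

instance (X : (TruncSet.{u} n)ᵒᵖ) : PreservesFiniteLimits (tensorLeft X) := by
  have := preservesFiniteLimits_op (tensorLeft X.unop)
  exact preservesFiniteLimits_of_natIso (F := (tensorLeft X.unop).op)
    (NatIso.ofComponents fun _ => Iso.refl _)

instance (X : (TruncSet.{u} n)ᵒᵖ) : PreservesFiniteLimits (tensorRight X) := by
  have := preservesFiniteLimits_op (tensorRight X.unop)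
  exact preservesFiniteLimits_of_natIso (F := (tensorRight X.unop).op)
    (NatIso.ofComponents fun _ => Iso.refl _)

/-- The free lex category on `□ₙ`, as the opposite of a category of finite truncated semi-cubical
sets, inherits the tensor product of truncated semi-cubical sets. Its unit is the point. -/
theorem exists_monoidal_of_isFreeLex {L : Type u} [SmallCategory L] {j : TruncSemiCube n ⥤ L}
    (hj : IsFreeLex j) :
    ∃ _ : MonoidalCategory L, IsLexMonoidal L ∧ Nonempty (nerve j).Monoidal ∧
      Nonempty (j.obj (TruncSemiCube.point n) ≅ 𝟙_ L) := by
  have hj' := isFreeLex_iff_isFiniteModel.1 hj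
  have : (nerve j).Full := hj'.full_homInto
  have : (nerve j).Faithful := hj'.faithful_homInto
  have : PreservesFiniteLimits (nerve j) := hj'.preservesFiniteLimits_homInto
  have := hj.hasFiniteLimits
  have hfin (Y : TruncSet.{u} n) : (nerve j).essImage (Opposite.op Y) ↔ Y.IsFinite :=
    hj'.essImage_iff Y
  obtain ⟨_, ⟨_⟩⟩ := exists_monoidal_of_fullyFaithful (nerve j) ((hfin _).2 isFinite_unit)
    (fun X Y => (hfin ((nerve j).obj X ⊗ (nerve j).obj Y).unop).2
      (((hfin _).1 ((nerve j).obj_mem_essImage X)).tensor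
        ((hfin _).1 ((nerve j).obj_mem_essImage Y))))
  refine ⟨inferInstance, isLexMonoidal_of_fullyFaithful (nerve j) inferInstance inferInstance,
    ⟨inferInstance⟩, ?_⟩
  have := hj'.full
  have := hj'.faithful
  let X : TruncSemiCube n ⥤ Type u :=
    ((nerve j).obj (j.obj (TruncSemiCube.point n))).unop
  have e (k : TruncSemiCube n) : X.obj k ≃ (TruncSemiCube.point n ⟶ k) :=
    (Functor.FullyFaithful.ofFullyFaithful j).homEquiv.symm
  have h₁ (k : TruncSemiCube n) (f g : TruncSemiCube.point n ⟶ k) : f = g := by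
    refine (TruncSemiCube.incl n).map_injective ?_
    generalize (TruncSemiCube.incl n).map f = f
    generalize (TruncSemiCube.incl n).map g = g
    exact SemiCube.Word.eq_of_zero f g
  obtain ⟨i⟩ := nonempty_iso_unit X ⟨(e _).symm (𝟙 _)⟩
    (fun k => ⟨fun x y => (e k).injective (h₁ k _ _)⟩)
    (fun k hk => ⟨fun x =>
      hk (Nat.le_zero.1 (SemiCube.Word.le ((TruncSemiCube.incl n).map (e k x))))⟩)
  exact ⟨(nerve j).preimageIso (i.symm.op ≪≫ Functor.Monoidal.εIso (nerve j))⟩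

end TruncSet

end

/-! ### Coinduced actions -/

noncomputable section

open scoped MonoidalLeftAction

section Coinduced

variable (M : Type u) [Category.{v} M] [MonoidalCategory M] (D : Type u₁) [Category.{v₁} D]

/-- The left action of a monoidal category `M` on functors `M ⥤ D`, given by translation of the
argument: `(m ⊙ F) x = F (x ⊗ m)`. -/
@[reducible]
def translationAction : MonoidalLeftAction M (M ⥤ D) where
  actionObj m F := tensorRight m ⋙ F
  actionHomLeft f F := Functor.whiskerRight ((tensoringRight M).map f) F
  actionHomRight m _ _ φ := Functor.whiskerLeft (tensorRight m) φ
  actionAssocIso m m' F := NatIso.ofComponents (fun x => F.mapIso (α_ x m m').symm)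
    (fun f => by simp [← Functor.map_comp])
  actionUnitIso F := Functor.isoWhiskerRight (rightUnitorNatIso M) F
  actionHom_comp _ _ _ _ := by
    ext x
    simp
  actionAssocIso_hom_naturality _ _ _ := by
    ext x
    simp [MonoidalCategory.tensorHom_def]
  whiskerLeft_actionHomLeft _ _ _ _ _ := by
    ext x
    simp [← Functor.map_comp]
  whiskerRight_actionHomLeft _ _ _ := by
    ext x
    simp [← Functor.map_comp]
  associator_actionHom _ _ _ _ := by
    ext x
    simp [← Functor.map_comp]
  leftUnitor_actionHom _ _ := by
    ext x
    simp [← Functor.map_comp]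
  rightUnitor_actionHom _ _ := by
    ext x
    simp [← Functor.map_comp]

attribute [local instance] translationAction

namespace translationAction

variable {M D} (F : M ⥤ D) (x m m' : M)

@[simp] theorem obj_map {x y : M} (f : x ⟶ y) : (m ⊙ₗ F).map f = F.map (f ▷ m) := rfl

@[simp] theorem homLeft_app {m m' : M} (f : m ⟶ m') : (f ⊵ₗ F).app x = F.map (x ◁ f) := rfl

@[simp] theorem homRight_app {F G : M ⥤ D} (φ : F ⟶ G) :
    (m ⊴ₗ φ).app x = φ.app (x ⊗ m) := rfl

@[simp] theorem assocIso_hom_app :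
    (αₗ m m' F).hom.app x = F.map (α_ x m m').inv := rfl

end translationAction

variable {M D} {C : Type u₂} [Category.{v₂} C] [MonoidalLeftAction M C]

namespace CategoryTheory.Functor

open LaxLeftLinear

/-- A natural transformation between functors with linear structures is equivariant if it commutes
with the structure morphisms. -/
def IsEquivariant {P : Type u₃} [Category.{v₃} P] [MonoidalLeftAction M P] {F G : C ⥤ P}
    [F.LaxLeftLinear M] [G.LaxLeftLinear M] (α : F ⟶ G) : Prop :=
  ∀ (m : M) (c : C), μₗ F m c ≫ α.app (m ⊙ₗ c) = m ⊴ₗ α.app c ≫ μₗ G m c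

/-- The structure of an equivariant functor, from a family of isomorphisms. -/
@[reducible]
def LeftLinear.ofIso {P : Type u₃} [Category.{v₃} P] [MonoidalLeftAction M P] {F : C ⥤ P}
    (μ : ∀ (m : M) (c : C), m ⊙ₗ F.obj c ≅ F.obj (m ⊙ₗ c))
    (naturality_left : ∀ {m m' : M} (f : m ⟶ m') (c : C),
      f ⊵ₗ F.obj c ≫ (μ m' c).hom = (μ m c).hom ≫ F.map (f ⊵ₗ c))
    (naturality_right : ∀ (m : M) {c c' : C} (f : c ⟶ c'),
      m ⊴ₗ F.map f ≫ (μ m c').hom = (μ m c).hom ≫ F.map (m ⊴ₗ f))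
    (associativity : ∀ (m m' : M) (c : C),
      (μ (m ⊗ m') c).hom ≫ F.map (αₗ m m' c).hom =
        (αₗ m m' (F.obj c)).hom ≫ m ⊴ₗ (μ m' c).hom ≫ (μ m (m' ⊙ₗ c)).hom)
    (unitality : ∀ c : C, (λₗ[M] (F.obj c)).hom = (μ (𝟙_ M) c).hom ≫ F.map (λₗ[M] c).hom) :
    F.LeftLinear M where
  μₗ m c := (μ m c).hom
  μₗ_naturality_left := naturality_left
  μₗ_naturality_right := naturality_right
  μₗ_associativity := associativity
  μₗ_unitality := unitality
  δₗ m c := (μ m c).inv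
  δₗ_naturality_left f c := by
    rw [← cancel_epi (μ _ c).hom, ← reassoc_of% (naturality_left f c)]
    simp
  δₗ_naturality_right m c c' f := by
    rw [← cancel_epi (μ m c).hom, ← reassoc_of% (naturality_right m f)]
    simp
  δₗ_associativity m m' c := by
    rw [← cancel_epi (μ _ c).hom, reassoc_of% (associativity m m' c)]
    simp
  δₗ_unitality_inv c := by
    have : λₗ[M] (F.obj c) = μ (𝟙_ M) c ≪≫ F.mapIso (λₗ[M] c) := Iso.ext (unitality c)
    rw [this]
    rfl
  μₗ_comp_δₗ m c := (μ m c).hom_inv_id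
  δₗ_comp_μₗ m c := (μ m c).inv_hom_id

section

variable (T : C ⥤ M ⥤ D) [T.LeftLinear M]

/-- The values of an equivariant functor `T : C ⥤ M ⥤ D` are determined by those at the unit:
`T c m ≅ T (m ⊙ c) 1`. -/
def translationIso (m : M) (c : C) :
    (T.obj c).obj m ≅ (T.obj (m ⊙ₗ c)).obj (𝟙_ M) :=
  (T.obj c).mapIso (λ_ m).symm ≪≫ (LeftLinear.μₗIso T m c).app (𝟙_ M)

theorem translationIso_naturality_left {m m' : M} (f : m ⟶ m') (c : C) :
    (T.obj c).map f ≫ (T.translationIso m' c).hom =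
      (T.translationIso m c).hom ≫ (T.map (f ⊵ₗ c)).app (𝟙_ M) := by
  have := congrArg (fun φ => φ.app (𝟙_ M)) (μₗ_naturality_left T f c)
  dsimp [translationIso] at this ⊢
  rw [Category.assoc, ← this, ← Functor.map_comp_assoc, ← Functor.map_comp_assoc,
    leftUnitor_inv_naturality]

theorem translationIso_naturality_right (m : M) {c c' : C} (g : c ⟶ c') :
    (T.map g).app m ≫ (T.translationIso m c').hom =
      (T.translationIso m c).hom ≫ (T.map (m ⊴ₗ g)).app (𝟙_ M) := by
  have := congrArg (fun φ => φ.app (𝟙_ M)) (μₗ_naturality_right T m g)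
  dsimp [translationIso] at this ⊢
  rw [Category.assoc, ← this, NatTrans.naturality_assoc]

theorem translationIso_associativity (x m : M) (c : C) :
    (T.translationIso (x ⊗ m) c).hom ≫ (T.map (αₗ x m c).hom).app (𝟙_ M) =
      (μₗ T m c).app x ≫ (T.translationIso x (m ⊙ₗ c)).hom := by
  have := congrArg (fun φ => φ.app (𝟙_ M)) (μₗ_associativity T x m c)
  dsimp [translationIso] at this ⊢
  rw [Category.assoc, this]
  have h := (μₗ T m c).naturality (λ_ x).inv
  dsimp at h
  rw [← reassoc_of% h, ← Functor.map_comp_assoc]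
  simp

theorem translationIso_unitality (c : C) :
    (T.translationIso (𝟙_ M) c).hom ≫ (T.map (λₗ[M] c).hom).app (𝟙_ M) = 𝟙 _ := by
  have := congrArg (fun φ => φ.app (𝟙_ M)) (μₗ_unitality T (C := M) c)
  dsimp [translationIso] at this ⊢
  rw [Category.assoc, ← this]
  exact ((T.obj c).map_comp (λ_ (𝟙_ M)).inv (ρ_ (𝟙_ M)).hom).symm.trans
    (by rw [← unitors_equal, Iso.inv_hom_id, Functor.map_id])

variable {T} {T' : C ⥤ M ⥤ D} [T'.LeftLinear M]

theorem IsEquivariant.translationIso {α : T ⟶ T'} (hα : IsEquivariant (M := M) α) (m : M) (c : C) :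
    (T.translationIso m c).hom ≫ (α.app (m ⊙ₗ c)).app (𝟙_ M) =
      (α.app c).app m ≫ (T'.translationIso m c).hom := by
  have := congrArg (fun φ => φ.app (𝟙_ M)) (hα m c)
  dsimp [Functor.translationIso] at this ⊢
  rw [Category.assoc, this, NatTrans.naturality_assoc]

/-- An equivariant transformation between functors `C ⥤ M ⥤ D` is determined by its values at the
unit. -/
theorem IsEquivariant.ext {α β : T ⟶ T'} (hα : IsEquivariant (M := M) α)
    (hβ : IsEquivariant (M := M) β) (h : ∀ c, (α.app c).app (𝟙_ M) = (β.app c).app (𝟙_ M)) :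
    α = β := by
  ext c m
  rw [← cancel_mono (T'.translationIso m c).hom, ← hα.translationIso, ← hβ.translationIso, h]

/-- A natural transformation between the values at the unit extends to an equivariant one. -/
theorem exists_isEquivariant
    (β : T ⋙ (evaluation M D).obj (𝟙_ M) ⟶ T' ⋙ (evaluation M D).obj (𝟙_ M)) :
    ∃ α : T ⟶ T', IsEquivariant (M := M) α ∧ ∀ c, (α.app c).app (𝟙_ M) = β.app c := by
  have hβ {c c' : C} (g : c ⟶ c') :
      (T.map g).app (𝟙_ M) ≫ β.app c' = β.app c ≫ (T'.map g).app (𝟙_ M) := β.naturality g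
  let α : T ⟶ T' :=
    { app := fun c =>
        { app := fun m =>
            (T.translationIso m c).hom ≫ β.app (m ⊙ₗ c) ≫ (T'.translationIso m c).inv
          naturality := fun m m' f => by
            rw [← cancel_mono (T'.translationIso m' c).hom]
            simp only [Category.assoc, Iso.inv_hom_id, Category.comp_id]
            rw [reassoc_of% (T.translationIso_naturality_left f c), hβ,
              T'.translationIso_naturality_left f c, Iso.inv_hom_id_assoc] }
      naturality := fun c c' g => by
        ext m
        dsimp
        rw [← cancel_mono (T'.translationIso m c').hom]
        simp only [Category.assoc, Iso.inv_hom_id, Category.comp_id]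
        rw [reassoc_of% (T.translationIso_naturality_right m g), hβ,
          T'.translationIso_naturality_right m g, Iso.inv_hom_id_assoc] }
  refine ⟨α, fun m c => ?_, fun c => ?_⟩
  · ext x
    change (μₗ T m c).app x ≫ (T.translationIso x (m ⊙ₗ c)).hom ≫ β.app (x ⊙ₗ m ⊙ₗ c) ≫
      (T'.translationIso x (m ⊙ₗ c)).inv = ((T.translationIso (x ⊗ m) c).hom ≫
        β.app ((x ⊗ m) ⊙ₗ c) ≫ (T'.translationIso (x ⊗ m) c).inv) ≫ (μₗ T' m c).app x
    rw [← cancel_mono (T'.translationIso x (m ⊙ₗ c)).hom]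
    simp only [Category.assoc, Iso.inv_hom_id, Category.comp_id]
    rw [← reassoc_of% (T.translationIso_associativity x m c), hβ,
      ← T'.translationIso_associativity x m c, Iso.inv_hom_id_assoc]
  · have h := T.translationIso_unitality c
    have h' := T'.translationIso_unitality c
    change (T.translationIso (𝟙_ M) c).hom ≫ β.app (𝟙_ M ⊙ₗ c) ≫
      (T'.translationIso (𝟙_ M) c).inv = β.app c
    rw [← cancel_mono (T'.translationIso (𝟙_ M) c).hom,
      ← cancel_mono ((T'.map (λₗ[M] c).hom).app (𝟙_ M))]
    simp only [Category.assoc, Iso.inv_hom_id_assoc]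
    rw [← hβ, reassoc_of% h, h', Category.comp_id]

end

end CategoryTheory.Functor

variable (M) in
/-- The functor `c ↦ (m ↦ H (m ⊙ c))`. -/
def coinduce (H : C ⥤ D) : C ⥤ M ⥤ D :=
  (MonoidalLeftAction.curriedAction M C).flip ⋙ (Functor.whiskeringRight M C D).obj H

instance (H : C ⥤ D) : (coinduce M H).LeftLinear M :=
  .ofIso (fun m c => NatIso.ofComponents (fun x => H.mapIso (αₗ x m c))
      fun {x y} f =>
        have h : (f ▷ m) ⊵ₗ c ≫ (αₗ y m c).hom = (αₗ x m c).hom ≫ f ⊵ₗ (m ⊙ₗ c) := by simp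
        (CommSq.map H ⟨h⟩).w)
    (fun {m m'} f c => by
      ext x
      have h : (x ◁ f) ⊵ₗ c ≫ (αₗ x m' c).hom = (αₗ x m c).hom ≫ x ⊴ₗ f ⊵ₗ c := by simp
      exact (CommSq.map H ⟨h⟩).w)
    (fun m c c' f => by
      ext x
      have h : (x ⊗ m) ⊴ₗ f ≫ (αₗ x m c').hom = (αₗ x m c).hom ≫ x ⊴ₗ m ⊴ₗ f := by simp
      exact (CommSq.map H ⟨h⟩).w)
    (fun m m' c => by
      ext x
      refine (H.map_comp (αₗ x (m ⊗ m') c).hom (x ⊴ₗ (αₗ m m' c).hom)).symm.trans ?_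
      refine (congrArg H.map ?_).trans ((H.map_comp ((α_ x m m').inv ⊵ₗ c) _).trans
        (congrArg _ (H.map_comp (αₗ (x ⊗ m) m' c).hom (αₗ x m (m' ⊙ₗ c)).hom)))
      rw [← MonoidalLeftAction.associator_actionHom,
        MonoidalLeftAction.inv_hom_actionHomLeft_assoc])
    (fun c => by
      ext x
      refine (congrArg H.map ?_).trans (H.map_comp (αₗ x (𝟙_ M) c).hom (x ⊴ₗ (λₗ c).hom))
      exact MonoidalLeftAction.rightUnitor_actionHom x c)

/-- The values at the unit of `c ↦ (m ↦ H (m ⊙ c))` are those of `H`. -/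
def coinduceCompEvaluation (H : C ⥤ D) : coinduce M H ⋙ (evaluation M D).obj (𝟙_ M) ≅ H :=
  NatIso.ofComponents (fun c => H.mapIso (λₗ[M] c)) fun {c c'} f =>
    have h : 𝟙_ M ⊴ₗ f ≫ (λₗ[M] c').hom = (λₗ[M] c).hom ≫ f := by simp
    (CommSq.map H ⟨h⟩).w

end Coinduced
end

/-! ### Restriction of actions along fully faithful functors -/

noncomputable section

open scoped MonoidalLeftAction
open CategoryTheory.Functor.LaxLeftLinear

section InducedAction

variable {M : Type u} [Category.{v} M] [MonoidalCategory M]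

variable {P : Type u₁} [Category.{v₁} P] {Q : Type u₂} [Category.{v₂} Q] [MonoidalLeftAction M Q]
  (N : P ⥤ Q) [N.Faithful]

/-- The laws of an action can be checked after applying a faithful functor which is compatible with
its operations. -/
@[reducible]
def inducedAction [MonoidalLeftActionStruct M P]
    (μ : ∀ (m : M) (p : P), m ⊙ₗ N.obj p ≅ N.obj (m ⊙ₗ p))
    (hl : ∀ {m m' : M} (f : m ⟶ m') (p : P),
      N.map (f ⊵ₗ p) = (μ _ p).inv ≫ f ⊵ₗ N.obj p ≫ (μ _ p).hom)
    (hr : ∀ (m : M) {p p' : P} (g : p ⟶ p'),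
      N.map (m ⊴ₗ g) = (μ m _).inv ≫ m ⊴ₗ N.map g ≫ (μ m _).hom)
    (hlr : ∀ {m m' : M} (f : m ⟶ m') {p p' : P} (g : p ⟶ p'),
      N.map (f ⊙ₗₘ g) = (μ _ _).inv ≫ (f ⊙ₗₘ N.map g) ≫ (μ _ _).hom)
    (ha : ∀ (m m' : M) (p : P), N.map (αₗ m m' p).hom = (μ _ p).inv ≫
      (αₗ m m' (N.obj p)).hom ≫ m ⊴ₗ (μ m' p).hom ≫ (μ m _).hom)
    (hu : ∀ p : P, N.map (λₗ[M] p).hom = (μ _ p).inv ≫ (λₗ[M] (N.obj p)).hom) :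
    MonoidalLeftAction M P :=
  have ha' (m m' : M) (p : P) : N.map (αₗ m m' p).inv = (μ m _).inv ≫ m ⊴ₗ (μ m' p).inv ≫
      (αₗ m m' (N.obj p)).inv ≫ (μ _ p).hom := by
    rw [← cancel_epi (N.map (αₗ m m' p).hom), ← N.map_comp, ha]
    simp
  { actionHom_def := fun _ _ => N.map_injective (by
      simp [hl, hr, hlr, MonoidalLeftAction.actionHom_def])
    actionHomRight_id := fun _ _ => N.map_injective (by simp [hr])
    id_actionHomLeft := fun _ _ => N.map_injective (by simp [hl])
    actionHom_comp := fun _ _ _ _ => N.map_injective (by simp [hlr])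
    actionAssocIso_hom_naturality := fun f g h => N.map_injective (by
      have := MonoidalLeftAction.actionAssocIso_hom_naturality f g (N.map h)
      simp only [Functor.map_comp, hlr, ha, Category.assoc, Iso.hom_inv_id_assoc]
      rw [reassoc_of% this]
      simp only [MonoidalLeftAction.actionHom_def, MonoidalLeftAction.actionHomRight_comp,
        Category.assoc]
      rw [MonoidalLeftAction.action_exchange_assoc]
      simp)
    actionUnitIso_hom_naturality := fun _ => N.map_injective (by simp [hu, hr])
    whiskerLeft_actionHomLeft := fun _ _ _ _ _ => N.map_injective (by simp [hl, hr, ha, ha'])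
    whiskerRight_actionHomLeft := fun m'' f p => N.map_injective (by
      simp only [Functor.map_comp, hl, ha, ha', Category.assoc, Iso.hom_inv_id_assoc,
        MonoidalLeftAction.whiskerRight_actionHomLeft]
      rw [MonoidalLeftAction.action_exchange_assoc]
      simp)
    associator_actionHom := fun m₁ m₂ m₃ p => N.map_injective (by simp [hl, hr, ha])
    leftUnitor_actionHom := fun m p => N.map_injective (by simp [hl, hu, ha])
    rightUnitor_actionHom := fun _ _ => N.map_injective (by simp [hl, hr, ha, hu]) }

/-- An action of `M` restricts along a fully faithful functor whose essential image is closed under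
the action. -/
theorem exists_action_of_fullyFaithful [N.Full]
    (h : ∀ (m : M) (p : P), N.essImage (m ⊙ₗ N.obj p)) :
    ∃ _ : MonoidalLeftAction M P, Nonempty (N.LeftLinear M) := by
  let a (m : M) (p : P) : P := (h m p).witness
  let μ (m : M) (p : P) : m ⊙ₗ N.obj p ≅ N.obj (a m p) := (h m p).getIso.symm
  let S : MonoidalLeftActionStruct M P :=
    { actionObj := a
      actionHomLeft := fun f p => N.preimage ((μ _ p).inv ≫ f ⊵ₗ N.obj p ≫ (μ _ p).hom)
      actionHomRight := fun m _ _ g => N.preimage ((μ m _).inv ≫ m ⊴ₗ N.map g ≫ (μ m _).hom)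
      actionHom := fun f g => N.preimage ((μ _ _).inv ≫ (f ⊙ₗₘ N.map g) ≫ (μ _ _).hom)
      actionAssocIso := fun m m' p => N.preimageIso ((μ _ p).symm ≪≫ αₗ m m' (N.obj p) ≪≫
        (MonoidalLeftAction.actionLeft Q m).mapIso (μ m' p) ≪≫ μ m _)
      actionUnitIso := fun p => N.preimageIso ((μ _ p).symm ≪≫ λₗ[M] (N.obj p)) }
  have hl {m m' : M} (f : m ⟶ m') (p : P) :
      N.map (f ⊵ₗ p) = (μ _ p).inv ≫ f ⊵ₗ N.obj p ≫ (μ _ p).hom := N.map_preimage _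
  have hr (m : M) {p p' : P} (g : p ⟶ p') :
      N.map (m ⊴ₗ g) = (μ m _).inv ≫ m ⊴ₗ N.map g ≫ (μ m _).hom := N.map_preimage _
  have ha (m m' : M) (p : P) : N.map (αₗ m m' p).hom = (μ _ p).inv ≫ (αₗ m m' (N.obj p)).hom ≫
      m ⊴ₗ (μ m' p).hom ≫ (μ m _).hom := N.map_preimage _
  have hu (p : P) : N.map (λₗ[M] p).hom = (μ _ p).inv ≫ (λₗ[M] (N.obj p)).hom :=
    N.map_preimage _
  let A := inducedAction N μ hl hr (fun _ _ _ _ => N.map_preimage _) ha hu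
  exact ⟨A, ⟨.ofIso μ (fun f p => by simp [hl]) (fun m _ _ g => by simp [hr])
      (fun m m' p => by simp [ha]; rfl) (fun p => by simp [hu])⟩⟩

end InducedAction

namespace CategoryTheory.Functor

variable {M : Type u} [Category.{v} M] [MonoidalCategory M] {C : Type u₁} [Category.{v₁} C]
  [MonoidalLeftAction M C] {P : Type u₂} [Category.{v₂} P] [MonoidalLeftAction M P]
  {Q : Type u₃} [Category.{v₃} Q] [MonoidalLeftAction M Q]

/-- The composite of two equivariant functors. -/
@[reducible]
def LeftLinear.comp (F : C ⥤ P) [F.LeftLinear M] (N : P ⥤ Q) [N.LeftLinear M] :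
    (F ⋙ N).LeftLinear M :=
  .ofIso (fun m c => LeftLinear.μₗIso N m (F.obj c) ≪≫ N.mapIso (LeftLinear.μₗIso F m c))
    (fun f c => by simp [← Functor.map_comp])
    (fun m _ _ f => by simp [← Functor.map_comp])
    (fun m m' c => by
      have h := congrArg N.map (μₗ_associativity F m m' c)
      simp only [Functor.map_comp] at h
      simp [h])
    (fun c => by simp [← Functor.map_comp])

/-- A functor is equivariant if its composite with a fully faithful equivariant functor is. -/
@[reducible]
def LeftLinear.lift {F : C ⥤ P} (N : P ⥤ Q) [N.Full] [N.Faithful] [N.LeftLinear M]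
    {T : C ⥤ Q} [T.LeftLinear M] (i : F ⋙ N ≅ T) : F.LeftLinear M :=
  let e (m : M) (c : C) : m ⊙ₗ N.obj (F.obj c) ≅ m ⊙ₗ T.obj c :=
    (MonoidalLeftAction.actionLeft Q m).mapIso (i.app c)
  let μ (m : M) (c : C) : m ⊙ₗ F.obj c ≅ F.obj (m ⊙ₗ c) :=
    N.preimageIso ((LeftLinear.μₗIso N m (F.obj c)).symm ≪≫ e m c ≪≫ LeftLinear.μₗIso T m c ≪≫
      (i.app (m ⊙ₗ c)).symm)
  have hμ (m : M) (c : C) : μₗ N m (F.obj c) ≫ N.map (μ m c).hom ≫ i.hom.app (m ⊙ₗ c) =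
      m ⊴ₗ i.hom.app c ≫ μₗ T m c := by
    have : N.map (μ m c).hom = OplaxLeftLinear.δₗ N m (F.obj c) ≫ m ⊴ₗ i.hom.app c ≫
      μₗ T m c ≫ i.inv.app (m ⊙ₗ c) := N.map_preimage _
    simp [this]
  have hi {c c' : C} (f : c ⟶ c') : N.map (F.map f) ≫ i.hom.app c' = i.hom.app c ≫ T.map f :=
    i.hom.naturality f
  .ofIso μ
    (fun f c => N.map_injective (by
      rw [← cancel_epi (μₗ N _ _), ← cancel_mono (i.hom.app _)]
      simp only [map_comp, Category.assoc, hi]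
      rw [← μₗ_naturality_left_assoc, hμ, reassoc_of% hμ, ← μₗ_naturality_left,
        MonoidalLeftAction.action_exchange_assoc]))
    (fun m c c' f => N.map_injective (by
      rw [← cancel_epi (μₗ N _ _), ← cancel_mono (i.hom.app _)]
      simp only [map_comp, Category.assoc, hi]
      rw [← μₗ_naturality_right_assoc, hμ, reassoc_of% hμ, ← μₗ_naturality_right,
        ← MonoidalLeftAction.actionHomRight_comp_assoc, hi,
        MonoidalLeftAction.actionHomRight_comp_assoc]))
    (fun m m' c => N.map_injective (by
      rw [← cancel_epi (μₗ N _ _), ← cancel_mono (i.hom.app _)]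
      simp only [map_comp, Category.assoc, hi]
      rw [reassoc_of% hμ, μₗ_associativity, μₗ_associativity_assoc, ← μₗ_naturality_right_assoc,
        hμ, ← MonoidalLeftAction.actionHomRight_comp_assoc m (μₗ N m' _),
        ← MonoidalLeftAction.actionHomRight_comp_assoc m, Category.assoc, hμ]
      simp))
    (fun c => N.map_injective (by
      rw [← cancel_epi (μₗ N _ _), ← cancel_mono (i.hom.app _)]
      simp only [map_comp, Category.assoc, hi]
      rw [reassoc_of% hμ, ← μₗ_unitality, ← μₗ_unitality_assoc]
      simp))

end CategoryTheory.Functor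
end

/-! ### Cofreely parametric lex categories of functors -/

noncomputable section

open scoped MonoidalLeftAction
open CategoryTheory.Functor.LaxLeftLinear

section Cofree

attribute [local instance] translationAction CategoryTheory.Functor.LeftLinear.comp

variable {M : Type u} [Category.{v} M] [MonoidalCategory M]

theorem CategoryTheory.Functor.isEquivariant_whiskerRight_iff {C : Type u₁} [Category.{v₁} C]
    [MonoidalLeftAction M C] {P : Type u₂} [Category.{v₂} P] [MonoidalLeftAction M P]
    {Q : Type u₃} [Category.{v₃} Q] [MonoidalLeftAction M Q] {F G : C ⥤ P} [F.LeftLinear M]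
    [G.LeftLinear M] (N : P ⥤ Q) [N.Faithful] [N.LeftLinear M] (α : F ⟶ G) :
    Functor.IsEquivariant (M := M) (Functor.whiskerRight α N) ↔
      Functor.IsEquivariant (M := M) α := by
  refine forall₂_congr fun m c => ?_
  change (μₗ N m (F.obj c) ≫ N.map (μₗ F m c)) ≫ N.map (α.app (m ⊙ₗ c)) =
    m ⊴ₗ N.map (α.app c) ≫ μₗ N m (G.obj c) ≫ N.map (μₗ G m c) ↔ _
  rw [μₗ_naturality_right_assoc, Category.assoc, cancel_epi, ← N.map_comp, ← N.map_comp]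
  exact N.map_injective.eq_iff

variable {D : Type u₃} [Category.{v₃} D]

/-- Lexness of a functor `G : C ⥤ P` can be tested on the evaluations of a fully faithful functor
`N : P ⥤ M ⥤ D`, provided that these are lex themselves. -/
theorem preservesFiniteLimits_of_evaluation_comp [HasFiniteLimits D] {M : Type u}
    [Category.{v} M] {C : Type u₁}
    [Category.{v₁} C] {P : Type u₂} [Category.{v₂} P] (N : P ⥤ M ⥤ D) [N.Full] [N.Faithful]
    (hN : ∀ m, PreservesFiniteLimits (N ⋙ (evaluation M D).obj m)) (G : C ⥤ P)
    (hG : ∀ m, PreservesFiniteLimits ((G ⋙ N) ⋙ (evaluation M D).obj m)) :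
    PreservesFiniteLimits G := by
  have : PreservesFiniteLimits (G ⋙ N) := preservesFiniteLimits_of_evaluation _ hG
  have : PreservesFiniteLimits N := preservesFiniteLimits_of_evaluation _ hN
  exact preservesFiniteLimits_of_reflects_of_preserves G N

variable [HasFiniteLimits D] {P : Type u₂} [Category.{v₂} P] [MonoidalLeftAction M P]

/-- A category of lex functors `M ⥤ D`, with the action of `M` by translation, is the cofreely
`M`-parametric lex category generated by `D`. -/
theorem isCofreeLexModule_of_fullyFaithful [IsLexMonoidal M] [HasFiniteLimits P] (N : P ⥤ M ⥤ D)
    [N.Full] [N.Faithful] [N.LeftLinear M]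
    (hN : ∀ m, PreservesFiniteLimits (N ⋙ (evaluation M D).obj m))
    (hN' : ∀ F, N.essImage F ↔ PreservesFiniteLimits F)
    (ε : P ⥤ D) (i : N ⋙ (evaluation M D).obj (𝟙_ M) ≅ ε) :
    IsCofreeLexModule.{v, u, v₁, u₁, v₂, u₂, v₃, u₃} M ε where
  isLexModule :=
    { hasFiniteLimits := inferInstance
      actionLeft_lex := fun m => by
        refine preservesFiniteLimits_of_evaluation_comp N hN _ fun x => ?_
        have := hN (x ⊗ m)
        exact preservesFiniteLimits_of_natIso (F := N ⋙ (evaluation M D).obj (x ⊗ m))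
          (NatIso.ofComponents (fun p => (Functor.LeftLinear.μₗIso N m p).app x) fun f =>
            congrArg (fun φ => φ.app x) (μₗ_naturality_right N m f))
      actionRight_lex := fun p => by
        refine preservesFiniteLimits_of_evaluation_comp N hN _ fun x => ?_
        have := IsLexMonoidal.tensorLeft_lex x
        have := (hN' _).1 (N.obj_mem_essImage p)
        have := comp_preservesFiniteLimits (tensorLeft x) (N.obj p)
        exact preservesFiniteLimits_of_natIso (F := tensorLeft x ⋙ N.obj p)
          (NatIso.ofComponents (fun m => (Functor.LeftLinear.μₗIso N m p).app x) fun f =>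
            congrArg (fun φ => φ.app x) (μₗ_naturality_left N f p)) }
  lex :=
    have := hN (𝟙_ M)
    preservesFiniteLimits_of_natIso i
  isEquivalence C _ _ _ := by
    have hi {p q : P} (f : p ⟶ q) : (N.map f).app (𝟙_ M) ≫ i.hom.app q = i.hom.app p ≫ ε.map f :=
      i.hom.naturality f
    refine ⟨⟨fun {F G α β} h => ?_⟩, ⟨fun {F G} β => ?_⟩, ⟨fun H => ?_⟩⟩
    · let _ := F.linear
      let _ := G.linear
      have h' (c : C) : ε.map (α.natTrans.app c) = ε.map (β.natTrans.app c) :=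
        congrArg (fun φ => ((leftExactFunctor C D).ι.map φ).app c) h
      have := ((Functor.isEquivariant_whiskerRight_iff N _).2 α.equivariant).ext
        ((Functor.isEquivariant_whiskerRight_iff N _).2 β.equivariant) fun c => by
          rw [← cancel_mono (i.hom.app _)]
          exact (hi _).trans ((congrArg _ (h' c)).trans (hi _).symm)
      exact EquivariantLexFunctor.Hom.ext
        (((Functor.whiskeringRight C P _).obj N).map_injective this)
    · let _ := F.linear
      let _ := G.linear
      let β' : F.functor ⋙ ε ⟶ G.functor ⋙ ε := (leftExactFunctor C D).ι.map β
      obtain ⟨α, hα, hα'⟩ := Functor.exists_isEquivariant (M := M) (T := F.functor ⋙ N)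
        (T' := G.functor ⋙ N)
        (Functor.whiskerLeft F.functor i.hom ≫ β' ≫ Functor.whiskerLeft G.functor i.inv)
      obtain ⟨γ, rfl⟩ := ((Functor.whiskeringRight C P _).obj N).map_surjective α
      refine ⟨⟨γ, (Functor.isEquivariant_whiskerRight_iff N _).1 hα⟩,
        (leftExactFunctor C D).ι.map_injective (NatTrans.ext (funext fun c => ?_))⟩
      change ε.map (γ.app c) = β'.app c
      have h := hα' c
      change (N.map (γ.app c)).app (𝟙_ M) = i.hom.app _ ≫ β'.app c ≫ i.inv.app _ at h
      rw [← cancel_epi (i.hom.app _), ← hi, h]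
      simp
    · have : PreservesFiniteLimits H.obj := H.property
      -- The values of `c ↦ (m ↦ H (m ⊙ c))` are lex, so that this functor lifts along `N`.
      let T := coinduce M H.obj
      have hT (c : C) : N.essImage (T.obj c) := by
        have := IsLexModule.actionRight_lex (M := M) c
        exact (hN' _).2 (comp_preservesFiniteLimits (MonoidalLeftAction.actionRight M c) H.obj)
      let F : C ⥤ P := Functor.essImage.liftFunctor T N hT
      let e : F ⋙ N ≅ T := Functor.essImage.liftFunctorCompIso T N hT
      have hF : PreservesFiniteLimits F := by
        refine preservesFiniteLimits_of_evaluation_comp N hN _ fun m => ?_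
        have := IsLexModule.actionLeft_lex (C := C) m
        have := comp_preservesFiniteLimits (MonoidalLeftAction.actionLeft C m) H.obj
        exact preservesFiniteLimits_of_natIso (F := MonoidalLeftAction.actionLeft C m ⋙ H.obj)
          (Functor.isoWhiskerRight e.symm ((evaluation M D).obj m))
      refine ⟨⟨F, hF, .lift N e⟩, ⟨(leftExactFunctor C D).ι.preimageIso ?_⟩⟩
      exact Functor.isoWhiskerLeft F i.symm ≪≫
        Functor.isoWhiskerRight e ((evaluation M D).obj (𝟙_ M)) ≪≫ coinduceCompEvaluation H.obj

end Cofree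

end

/-! ### Truncated semi-cubical objects -/

noncomputable section

section RightKanExtension

variable {K : Type u₁} [Category.{v₁} K] {L : Type u₂} [Category.{v₂} L] {j : K ⥤ L}

/-- The essential image of right Kan extension along a finite limit completion consists of the lex
functors. -/
theorem IsFiniteLimitCompletion.essImage_ran_iff (hj : IsFiniteLimitCompletion j) {D : Type u₃}
    [Category.{v₃} D] [∀ G : K ⥤ D, j.HasPointwiseRightKanExtension G] (F : L ⥤ D) :
    (j.ran (H := D)).essImage F ↔ PreservesFiniteLimits F := by
  refine ⟨fun ⟨G, ⟨e⟩⟩ => ?_, fun _ => ?_⟩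
  · have := hj.preservesFiniteLimits G _ _ (j.isPointwiseRightKanExtensionRanCounit G)
    exact preservesFiniteLimits_of_natIso e
  · have := hj.isRightKanExtension F
    exact ⟨j ⋙ F, ⟨Functor.rightKanExtensionUnique _ ((j.ranCounit (H := D)).app (j ⋙ F)) _
      (𝟙 (j ⋙ F))⟩⟩

/-- If a finite limit completion `L` of `K` is a lex monoidal category and `j p` is its unit, then
the category of functors `K ⥤ D` is the cofreely `L`-parametric lex category generated by `D`: by
right Kan extension it is the category of lex functors `L ⥤ D`. -/
theorem IsFiniteLimitCompletion.exists_isCofreeLexModule (hj : IsFiniteLimitCompletion j)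
    [MonoidalCategory L] [IsLexMonoidal L] {p : K} (i : j.obj p ≅ 𝟙_ L) (D : Type u₃)
    [Category.{v₃} D] [HasFiniteLimits D] :
    ∃ _ : MonoidalLeftAction L (K ⥤ D),
      IsCofreeLexModule.{v₂, u₂, v, u, _, _, v₃, u₃} L ((evaluation K D).obj p) := by
  have := hj.full
  have := hj.faithful
  have (G : K ⥤ D) : j.HasPointwiseRightKanExtension G := hj.hasPointwiseRightKanExtension G
  have : (j.ran (H := D)).Full := (j.ranAdjunction D).fullyFaithfulROfIsIsoCounit.full
  have : (j.ran (H := D)).Faithful := (j.ranAdjunction D).fullyFaithfulROfIsIsoCounit.faithful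
  have : (j.ran (H := D)).IsRightAdjoint := (j.ranAdjunction D).isRightAdjoint
  let _ := translationAction L D
  obtain ⟨_, ⟨_⟩⟩ := exists_action_of_fullyFaithful (M := L) (j.ran (H := D)) fun m G => by
    have := (hj.essImage_ran_iff _).1 (j.ran.obj_mem_essImage G)
    have := IsLexMonoidal.tensorRight_lex m
    exact (hj.essImage_ran_iff _).2 (comp_preservesFiniteLimits (tensorRight m) (j.ran.obj G))
  exact ⟨inferInstance, isCofreeLexModule_of_fullyFaithful j.ran
    (fun m => comp_preservesFiniteLimits j.ran ((evaluation L D).obj m)) hj.essImage_ran_iff _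
    (Functor.isoWhiskerLeft j.ran ((evaluation L D).mapIso i.symm) ≪≫
      Functor.isoWhiskerRight (asIso (j.ranAdjunction D).counit) ((evaluation K D).obj p))⟩

end RightKanExtension

end

theorem mainTheorem6 (n : ℕ) :
    -- the monoidal structure on `Set^{□ₙ}` inherited from Day convolution
    ∃ _ : MonoidalCategory (TruncSet.{u} n),
      Nonempty (TruncSet.restrict.{u} n).Monoidal ∧
      Nonempty (curriedTensor (TruncSet.{u} n) ≅ TruncSet.dayTensor.{u} n) ∧
      (∀ X : TruncSet.{u} n,
        PreservesColimits (tensorLeft X) ∧ PreservesColimits (tensorRight X)) ∧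
      -- the free lex category on `□ₙ` exists
      (∃ (L : Type u) (_ : SmallCategory L) (j : TruncSemiCube n ⥤ L), IsFreeLex j) ∧
      -- and it is a monoidal lex category, by restriction of this structure
      ∀ (L : Type u) [SmallCategory L] (j : TruncSemiCube n ⥤ L), IsFreeLex j →
        ∃ _ : MonoidalCategory L,
          IsLexMonoidal L ∧
          (TruncSet.nerve j).Full ∧ (TruncSet.nerve j).Faithful ∧
          PreservesFiniteLimits (TruncSet.nerve j) ∧
          Nonempty (TruncSet.nerve j).Monoidal ∧
          -- its cofreely parametric lex categories are those of `n`-truncated semi-cubical objects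
          ∀ (D : Type u₁) [Category.{v₁} D] [HasFiniteLimits D],
            ∃ _ : MonoidalLeftAction L (TruncSemiCube n ⥤ D),
              IsCofreeLexModule.{u, u, v₂, u₂, _, _, v₁, u₁} L
                ((evaluation (TruncSemiCube n) D).obj (TruncSemiCube.point n)) := by
  refine ⟨TruncSet.monoidal n, ⟨TruncSet.restrictMonoidal n⟩, ⟨TruncSet.curriedTensorIso n⟩,
    fun X => ⟨inferInstance, inferInstance⟩, ?_, fun L _ j hj => ?_⟩
  · obtain ⟨L, _, j, hj⟩ := exists_isFiniteModel.{u} (TruncSemiCube n)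
    exact ⟨L, _, j, isFreeLex_iff_isFiniteModel.2 hj⟩
  · have hj' := isFreeLex_iff_isFiniteModel.1 hj
    obtain ⟨_, hL, hN, ⟨i⟩⟩ := TruncSet.exists_monoidal_of_isFreeLex hj
    exact ⟨inferInstance, hL, hj'.full_homInto, hj'.faithful_homInto,
      hj'.preservesFiniteLimits_homInto, hN,
      fun D _ _ => hj'.isFiniteLimitCompletion.exists_isCofreeLexModule i D⟩
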